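/- **Theorem (soundness with respect to the operational semantics).** Let $V$ be a finite set of variables. A *probability generating automaton* (PGA) is a weighted automaton $\mathcal A=(Q,M,I,F)$ with a finite non-empty state set $Q$, whose transition, initial and final weights have the form $r$ or $rX$ ($r\in\mathbb R_{\ge 0}$, $X\in V$) in the semiring of formal power series over the commutative monoid $\mathbb N^V$ with coefficients in $[0,\infty]$, and whose behavior $[\![\mathcal A]\!]=I M^{*}F$, $M^*=\sum_{n}M^n$, has mass $|\mathcal A|=\sum_{\sigma\in\mathbb N^V}[\![\mathcal A]\!](\sigma)\le 1$. It is *normalized* if no variable occurs in its initial and final weights. If $|\mathcal A|>0$, then $\mathrm{norm}(\mathcal A)$ is $\mathcal A$ with all initial weights multiplied by $1/|\mathcal A|$; otherwise $\mathrm{norm}(\mathcal A)$ is undefined. *Programs* (loop-free ReDiP without iid statements) are given by $$P ::= X:=0 \mid X \mathrel{+}= n \mid X\mathrel{+}=D \mid X\mathrel{+}=Y \mid \{P\}[p]\{P\} \mid \mathtt{if}\,(\varphi)\{P\}\,\mathtt{else}\,\{P\} \mid X\text{-}\text{-} \mid \mathtt{observe}(\varphi) \mid P;P$$ with $X,Y\in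 V$, $n\in\mathbb N$, $p\in[0,1]$, guards $\varphi ::= X<n \mid X\equiv_m n\ (n<m) \mid \varphi\wedge\varphi\mid\neg\varphi$, and $D$ a probability distribution on $\mathbb N$ whose generating function $\sum_n D(n)X^n$ is the behavior of some normalized PGA; fix an arbitrary choice of such a PGA $\mathcal A_{D_X}$ for each such $D$ and $X$. Guards are translated to deterministic finite automata $\mathcal B_\varphi$ over $V$ (counting up to $n$ for $X<n$, counting modulo $m$ for $X\equiv_m n$, product for $\wedge$, complement for $\neg$). The automata transformer $\langle P\rangle$ is defined by recursion on $P$: * $\langle X:=0\rangle(\mathcal A)=\mathcal A[X/1]$: every transition $rX$ becomes $r$; * $\langle X\mathrel{+}=n\rangle(\mathcal A)$ and $\langle X\mathrel{+}=D\rangle(\mathcal A)$ are the concatenations of $\mathcal A$ with a chain of $n$ many $X$-transitions and with $\mathcal A_{D_X}$, respectively; * $\langle X\mathrel{+}=Y\rangle(\mathcal A)$: every transition $rY$ is replaced by $\xrightarrow{r}\circ\xrightarrow{Y}\circ\xrightarrow{X}\circ\xrightarrow{1}$ through fresh states; * $\langle\{P_1\}[p]\{P_2\}\rangle(\mathcal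 A)$ is the disjoint union of $\langle P_1\rangle(\mathcal A)$ and $\langle P_2\rangle(\mathcal A)$ with initial weights scaled by $p$ and $1-p$; * $\langle\mathtt{observe}(\varphi)\rangle(\mathcal A)=\mathcal A\times\mathcal B_\varphi$, the product in which $X$-transitions are taken jointly and transitions without a variable only by $\mathcal A$; * $\langle\mathtt{if}(\varphi)\{P_1\}\mathtt{else}\{P_2\}\rangle(\mathcal A)=\langle P_1\rangle(\mathcal A\times\mathcal B_\varphi)\oplus\langle P_2\rangle(\mathcal A\times\mathcal B_{\neg\varphi})$, where $\oplus$ is disjoint union; * $\langle X\text{-}\text{-}\rangle(\mathcal A)$ is the disjoint union of $\mathcal A[X/0]$ (the transitions $rX$ are deleted) and of $\mathcal A\times\mathcal B_{X>0}$ with the label $rX$ replaced by $r$ on the transitions along which $\mathcal B_{X>0}$ moves from its initial to its accepting state; * $\langle P_1;P_2\rangle(\mathcal A)=\langle P_2\rangle(\langle P_1\rangle(\mathcal A))$. The *operational Markov chain* of $P$ with prior $\mathcal A$ has the states $\langle P',\sigma\rangle$, $\langle{\downarrow},\sigma\rangle$ (for programs $P'$ and $\sigma\in\mathbb N^V$)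 and $\langle\mathsf{fail}\rangle$. Its initial weight is $[\![\mathcal A]\!](\sigma)$ at $\langle P,\sigma\rangle$ and $0$ elsewhere. Its transitions are the usual small steps: an assignment or increment leads to $\langle{\downarrow},\sigma'\rangle$ with the updated valuation $\sigma'$ (decrement is truncated at $0$; $X\mathrel{+}=D$ adds $n$ to $X$ with probability $D(n)$); $\{P_1\}[p]\{P_2\}$ continues with $P_1$ with probability $p$ and with $P_2$ with probability $1-p$; $\mathtt{if}$ continues with the branch selected by the guard; $\mathtt{observe}(\varphi)$ leads to $\langle{\downarrow},\sigma\rangle$ if $\sigma\models\varphi$ and to $\langle\mathsf{fail}\rangle$ otherwise; $P_1;P_2$ steps in $P_1$, continues with $P_2$ once $P_1$ has terminated, and leads to $\langle\mathsf{fail}\rangle$ if $P_1$ does. The probabilities of different rules leading to the same state are added, and $\langle{\downarrow},\sigma\rangle$ and $\langle\mathsf{fail}\rangle$ are absorbing. Let $\Pr$ be the induced measure on infinite runs (of total mass $|\mathcal A|$), and let $\Diamond s$ be the event that the state $s$ is eventually reached. Then for every *normalized* PGA $\mathcal A$ and every such program $P$: 1. $\Pr(\Diamond\langle{\downarrow},\sigma\rangle)=[\![\langle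 P\rangle(\mathcal A)]\!](\sigma)$ for all $\sigma\in\mathbb N^V$; 2. $|\langle P\rangle(\mathcal A)|\le|\mathcal A|$ and $\Pr(\Diamond\langle\mathsf{fail}\rangle)=|\mathcal A|-|\langle P\rangle(\mathcal A)|$; 3. if $\mathrm{norm}(\langle P\rangle(\mathcal A))$ is defined, then for all $\sigma\in\mathbb N^V$ $$[\![\mathrm{norm}(\langle P\rangle(\mathcal A))]\!](\sigma)=\Pr\bigl(\Diamond\langle{\downarrow},\sigma\rangle\mid\neg\Diamond\langle\mathsf{fail}\rangle\bigr),$$ where $\Pr(E\mid G)=\Pr(E\cap G)/\Pr(G)$. -/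

import Mathlib

open MeasureTheory ProbabilityTheory
open scoped ENNReal NNReal

namespace ReDiP

/-! ### Formal power series and weighted automata -/

/-- Variable valuations `ℕ^V` for a finite set `V` of variables, which is also the commutative
monoid of monomials over `V`. -/
abbrev Val (V : Type*) := V →₀ ℕ

/-- Formal power series over `ℕ^V` with coefficients in `[0, ∞]`. -/
abbrev FPS (V : Type*) := MvPowerSeries V ℝ≥0∞

/-- The power series with given coefficients. -/
def FPS.mk {V : Type*} (g : Val V → ℝ≥0∞) : FPS V := g

theorem FPS.coeff_mk {V : Type*} (g : Val V → ℝ≥0∞) (σ : Val V) :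
    MvPowerSeries.coeff σ (FPS.mk g) = g σ := rfl

/-- A weighted automaton `(Q, M, I, F)` over a semiring `S`. -/
structure WAut (S : Type*) where
  /-- the finite non-empty set of states -/
  Q : Type
  [fintypeQ : Fintype Q]
  [nonemptyQ : Nonempty Q]
  /-- the transition matrix -/
  M : Matrix Q Q S
  /-- the initial weights -/
  I : Q → S
  /-- the final weights -/
  F : Q → S

attribute [instance] WAut.fintypeQ WAut.nonemptyQ

open Classical in
/-- `M^* = ∑ₙ Mⁿ`. Infinite sums of power series are taken coefficientwise in `[0, ∞]`. -/
noncomputable def kleeneStar {V Q : Type*} [Fintype Q] (M : Matrix Q Q (FPS V)) :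
    Matrix Q Q (FPS V) :=
  Matrix.of fun s t => FPS.mk fun σ => ∑' n : ℕ, MvPowerSeries.coeff σ ((M ^ n) s t)

namespace WAut

variable {V : Type*}

/-- The behavior `I M^* F` of an automaton. -/
noncomputable def behavior (A : WAut (FPS V)) : FPS V :=
  ∑ s, ∑ t, A.I s * kleeneStar A.M s t * A.F t

/-- The coefficient of the valuation `σ` in the behavior. -/
noncomputable def coeff (A : WAut (FPS V)) (σ : Val V) : ℝ≥0∞ :=
  MvPowerSeries.coeff σ A.behavior

/-- The mass of the behavior: the sum of all its coefficients. -/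
noncomputable def mass (A : WAut (FPS V)) : ℝ≥0∞ := ∑' σ : Val V, A.coeff σ

/-- The admissible labels: `r` and `r X`, with `r` a finite non-negative real and `X ∈ V`. -/
def IsLabel (f : FPS V) : Prop :=
  ∃ r : ℝ≥0, f = MvPowerSeries.C (r : ℝ≥0∞) ∨
    ∃ X : V, f = MvPowerSeries.C (r : ℝ≥0∞) * MvPowerSeries.X X

/-- A probability generating automaton (PGA): all transition, initial and final weights are
admissible labels, and the behavior has mass at most one. -/
def IsPGA (A : WAut (FPS V)) : Prop :=
  (∀ s t, IsLabel (A.M s t)) ∧ (∀ s, IsLabel (A.I s)) ∧ (∀ s, IsLabel (A.F s)) ∧ A.mass ≤ 1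

/-- Normalized automata: no variable occurs in an initial or final weight. -/
def IsNormalized (A : WAut (FPS V)) : Prop :=
  ∀ (s : A.Q) (σ : Val V),
    (MvPowerSeries.coeff σ (A.I s) ≠ 0 ∨ MvPowerSeries.coeff σ (A.F s) ≠ 0) → σ = 0

open Classical in
/-- `norm(A)`: the initial weights are multiplied by `1 / mass`; undefined if the mass is `0`. -/
noncomputable def normalize (A : WAut (FPS V)) : Option (WAut (FPS V)) :=
  if A.mass = 0 then none
  else some { A with I := fun s => MvPowerSeries.C (1 / A.mass) * A.I s }

/-! ### Automata constructions -/

/-- Concatenation. -/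
noncomputable def concat (A B : WAut (FPS V)) : WAut (FPS V) where
  Q := A.Q ⊕ B.Q
  M := Matrix.fromBlocks A.M (Matrix.of fun s t => A.F s * B.I t) 0 B.M
  I := Sum.elim A.I 0
  F := Sum.elim 0 B.F

/-- Disjoint union, the initial weights being multiplied by `p` and `q`, respectively. -/
noncomputable def wunion (A B : WAut (FPS V)) (p q : ℝ≥0∞) : WAut (FPS V) where
  Q := A.Q ⊕ B.Q
  M := Matrix.fromBlocks A.M 0 0 B.M
  I := Sum.elim (fun s => MvPowerSeries.C p * A.I s) (fun s => MvPowerSeries.C q * B.I s)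
  F := Sum.elim A.F B.F

/-- The weight `r` of the part `r X` of a label. -/
noncomputable def letterWeight (X : V) (f : FPS V) : ℝ≥0∞ :=
  MvPowerSeries.coeff (Finsupp.single X 1) f

open Classical in
/-- A label without its part `r X`. -/
noncomputable def dropLetter (X : V) (f : FPS V) : FPS V :=
  FPS.mk fun σ => if σ = Finsupp.single X 1 then 0 else MvPowerSeries.coeff σ f

/-- In a label, replace `r X` by `r i`. -/
noncomputable def substLabel (X : V) (i : ℝ≥0∞) (f : FPS V) : FPS V :=
  dropLetter X f + MvPowerSeries.C (letterWeight X f * i)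

/-- Transition label substitution `A[X/i]`, used with `i = 0` and `i = 1`. -/
noncomputable def labelSubst (A : WAut (FPS V)) (X : V) (i : ℝ≥0∞) : WAut (FPS V) :=
  { A with M := Matrix.of fun s t => substLabel X i (A.M s t) }

/-- Transition substitution `A[X/B]`: every transition `r X` from `s` to `t` is replaced by a fresh
copy of `B` (with states `inr ((s, t), b)`), entered from `s` with weight `r` times the initial
weights of `B`, and left to `t` with the final weights of `B`. If there is no such transition,
then `r = 0` and the copy of `B` is unreachable. -/
noncomputable def transSubst (A : WAut (FPS V)) (X : V) (B : WAut (FPS V)) : WAut (FPS V) := by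
  classical
  exact
  { Q := A.Q ⊕ ((A.Q × A.Q) × B.Q)
    M := Matrix.fromBlocks
      (Matrix.of fun s t => dropLetter X (A.M s t))
      (Matrix.of fun s e => if e.1.1 = s then
        MvPowerSeries.C (letterWeight X (A.M e.1.1 e.1.2)) * B.I e.2 else 0)
      (Matrix.of fun e t => if e.1.2 = t then B.F e.2 else 0)
      (Matrix.of fun e e' => if e.1 = e'.1 then B.M e.2 e'.2 else 0)
    I := Sum.elim A.I 0
    F := Sum.elim A.F 0 }

open Classical in
/-- The product of a weighted automaton with a finite deterministic automaton over the alphabet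
`V`: an `X`-transition is taken jointly, an `ε`-transition is taken by the first component only. -/
noncomputable def prod {R : Type} [Fintype R] (A : WAut (FPS V)) (B : DFA V R) :
    WAut (FPS V) :=
  haveI : Nonempty R := ⟨B.start⟩
  { Q := A.Q × R
    M := Matrix.of fun x y => FPS.mk fun σ =>
      if σ = 0 then (if x.2 = y.2 then MvPowerSeries.coeff 0 (A.M x.1 y.1) else 0)
      else if ∃ X, σ = Finsupp.single X 1 ∧ B.step x.2 X = y.2 then
        MvPowerSeries.coeff σ (A.M x.1 y.1)
      else 0
    I := fun x => A.I x.1 * (if x.2 = B.start then 1 else 0)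
    F := fun x => A.F x.1 * (if x.2 ∈ B.accept then 1 else 0) }

/-- The automaton for the Dirac distribution `X = n`: a chain of `n` many `X`-transitions. -/
noncomputable def dirac (X : V) (n : ℕ) : WAut (FPS V) where
  Q := Fin (n + 1)
  M := Matrix.of fun i j => if j.val = i.val + 1 then MvPowerSeries.X X else 0
  I := fun i => if i.val = 0 then 1 else 0
  F := fun i => if i.val = n then 1 else 0

/-- The automaton consisting of a `Y`-transition followed by an `X`-transition. -/
noncomputable def twoStep (Y X : V) : WAut (FPS V) where
  Q := Fin 3
  M := !![0, MvPowerSeries.X Y, 0; 0, 0, MvPowerSeries.X X; 0, 0, 0]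
  I := ![1, 0, 0]
  F := ![0, 0, 1]

end WAut

/-! ### Guards -/

/-- Rectangular guards: `X < n`, `X ≡ n (mod m)` with `n < m`, conjunction, and negation. -/
inductive Guard (V : Type*) where
  | lt (X : V) (n : ℕ)
  | congr (X : V) (m n : ℕ) (h : n < m)
  | and (φ ψ : Guard V)
  | not (φ : Guard V)

/-- `φ.Sat σ` means `σ ⊨ φ`. -/
def Guard.Sat {V : Type*} : Guard V → Val V → Prop
  | .lt X n, σ => σ X < n
  | .congr X m n _, σ => σ X ≡ n [MOD m]
  | .and φ ψ, σ => φ.Sat σ ∧ ψ.Sat σ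
  | .not φ, σ => ¬ φ.Sat σ

open Classical in
/-- The automaton for `X < n` counts the letters `X` up to `n`. For `n = 0` it has a single state,
which is not accepting. -/
noncomputable def ltDFA {V : Type*} (X : V) (n : ℕ) : DFA V (Fin (n + 1)) where
  step i Y := if Y = X then ⟨min (i.val + 1) n, by omega⟩ else i
  start := 0
  accept := {i | i.val < n}

open Classical in
/-- The automaton for `X ≡ n (mod m)` counts the letters `X` modulo `m`. -/
noncomputable def congrDFA {V : Type*} (X : V) (m n : ℕ) (h : n < m) : DFA V (Fin m) where
  step i Y := if Y = X then ⟨(i.val + 1) % m, Nat.mod_lt _ (by omega)⟩ else i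
  start := ⟨0, by omega⟩
  accept := {i | i.val = n}

/-- A deterministic automaton together with its finite set of states. -/
structure FinDFA (V : Type*) where
  /-- the states -/
  R : Type
  [fintypeR : Fintype R]
  /-- the automaton -/
  aut : DFA V R

attribute [instance] FinDFA.fintypeR

/-- The automaton `B_φ` of a guard. -/
noncomputable def Guard.dfa {V : Type*} : Guard V → FinDFA V
  | .lt X n => ⟨Fin (n + 1), ltDFA X n⟩
  | .congr X m n h => ⟨Fin m, congrDFA X m n h⟩
  | .and φ ψ => ⟨φ.dfa.R × ψ.dfa.R, φ.dfa.aut.inter ψ.dfa.aut⟩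
  | .not φ => ⟨φ.dfa.R, φ.dfa.autᶜ⟩

namespace WAut

variable {V : Type*}

/-- The product `A × B_φ`. -/
noncomputable def filter (A : WAut (FPS V)) (φ : Guard V) : WAut (FPS V) := A.prod φ.dfa.aut

/-- The product `A × B_{X > 0}`, in which every transition `r X` from `(q, s)` to `(u, t)` has been
replaced by `r`, where `s = 0` and `t = 1` are the two states of `B_{X > 0} = (B_{X < 1})ᶜ`. -/
noncomputable def decrPos (A : WAut (FPS V)) (X : V) : WAut (FPS V) where
  Q := A.Q × Fin 2
  M := Matrix.of fun x y =>
    if x.2 = 0 ∧ y.2 = 1 then substLabel X 1 ((A.prod (ltDFA X 1)ᶜ).M x y)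
    else (A.prod (ltDFA X 1)ᶜ).M x y
  I := (A.prod (ltDFA X 1)ᶜ).I
  F := (A.prod (ltDFA X 1)ᶜ).F

/-- The decrement automaton. -/
noncomputable def decr (A : WAut (FPS V)) (X : V) : WAut (FPS V) :=
  (A.decrPos X).wunion (A.labelSubst X 0) 1 1

open Classical in
/-- `A.Represents X D`: `A` is a normalized PGA whose behavior is the generating function
`∑ₙ D(n) Xⁿ` of the distribution `D` in the variable `X`. -/
def Represents (A : WAut (FPS V)) (X : V) (D : PMF ℕ) : Prop :=
  A.IsPGA ∧ A.IsNormalized ∧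
    ∀ σ : Val V, A.coeff σ = if σ = Finsupp.single X (σ X) then D (σ X) else 0

end WAut

/-- The distribution `D` on `ℕ` is PGA-definable (with respect to the variable `X`). -/
def PGADefinable {V : Type*} (X : V) (D : PMF ℕ) : Prop :=
  ∃ A : WAut (FPS V), A.Represents X D

/-! ### Programs -/

/-- Loop-free `ReDiP` programs without `iid` statements. -/
inductive Prog (V : Type*) where
  /-- `X := 0` -/
  | setZero (X : V)
  /-- `X += n` -/
  | incrConst (X : V) (n : ℕ)
  /-- `X += D`, for a PGA-definable probability distribution `D` -/
  | incrSample (X : V) (D : PMF ℕ) (hD : PGADefinable X D)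
  /-- `X += Y` -/
  | incrVar (X Y : V)
  /-- `{P₁} [p] {P₂}` -/
  | choice (P₁ : Prog V) (p : unitInterval) (P₂ : Prog V)
  /-- `if φ then P₁ else P₂` -/
  | ite (φ : Guard V) (P₁ P₂ : Prog V)
  /-- `X--` -/
  | decr (X : V)
  /-- `observe φ` -/
  | observe (φ : Guard V)
  /-- `P₁ ; P₂` -/
  | seq (P₁ P₂ : Prog V)

/-- The automata transformer `⟦P⟧`, for a given choice `𝒟 X D` of automata for the PGA-definable
distributions. -/
noncomputable def Prog.trans {V : Type*} (𝒟 : V → PMF ℕ → WAut (FPS V)) :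
    Prog V → WAut (FPS V) → WAut (FPS V)
  | .setZero X, A => A.labelSubst X 1
  | .incrConst X n, A => A.concat (WAut.dirac X n)
  | .incrSample X D _, A => A.concat (𝒟 X D)
  | .incrVar X Y, A => A.transSubst Y (WAut.twoStep Y X)
  | .choice P₁ p P₂, A =>
      (P₁.trans 𝒟 A).wunion (P₂.trans 𝒟 A) (unitInterval.toNNReal p)
        (unitInterval.toNNReal (unitInterval.symm p))
  | .ite φ P₁ P₂, A => (P₁.trans 𝒟 (A.filter φ)).wunion (P₂.trans 𝒟 (A.filter φ.not)) 1 1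
  | .decr X, A => A.decr X
  | .observe φ, A => A.filter φ
  | .seq P₁ P₂, A => P₂.trans 𝒟 (P₁.trans 𝒟 A)

/-! ### The operational Markov chain -/

/-- The states of the operational Markov chain. -/
inductive State (V : Type*) where
  /-- `⟨P, σ⟩`: the program `P` is to be executed in the valuation `σ` -/
  | run (P : Prog V) (σ : Val V)
  /-- `⟨↓, σ⟩`: the program has terminated in the valuation `σ` -/
  | term (σ : Val V)
  /-- `⟨↯⟩`: an observation was violated -/
  | fail

/-- The biased coin: `true` with probability `p` and `false` with probability `1 - p`. -/
noncomputable def coin (p : unitInterval) : PMF Bool :=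
  PMF.ofFintype (fun b => ((if b then unitInterval.toNNReal p
    else unitInterval.toNNReal (unitInterval.symm p) : ℝ≥0) : ℝ≥0∞)) (by
      rw [Fintype.sum_bool]
      simp only [if_true, Bool.false_eq_true, if_false]
      exact_mod_cast unitInterval.toNNReal_add_toNNReal_symm p)

/-- Continue a state with the program `P₂`. -/
def State.andThen {V : Type*} (P₂ : Prog V) : State V → State V
  | .run P₁ σ => .run (P₁.seq P₂) σ
  | .term σ => .run P₂ σ
  | .fail => .fail

open Classical in
/-- The distribution of the successor state of `⟨P, σ⟩`. The probabilities of several rules that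
lead to the same state are added. -/
noncomputable def Prog.step {V : Type*} : Prog V → Val V → PMF (State V)
  | .setZero X, σ => PMF.pure (.term (σ.update X 0))
  | .incrConst X n, σ => PMF.pure (.term (σ.update X (σ X + n)))
  | .incrSample X D _, σ => D.map fun n => .term (σ.update X (σ X + n))
  | .incrVar X Y, σ => PMF.pure (.term (σ.update X (σ X + σ Y)))
  | .choice P₁ p P₂, σ => (coin p).map fun b => if b then .run P₁ σ else .run P₂ σ
  | .ite φ P₁ P₂, σ => PMF.pure (if φ.Sat σ then .run P₁ σ else .run P₂ σ)
  | .decr X, σ => PMF.pure (.term (σ.update X (σ X - 1)))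
  | .observe φ, σ => PMF.pure (if φ.Sat σ then .term σ else .fail)
  | .seq P₁ P₂, σ => (P₁.step σ).map (State.andThen P₂)

/-- The rows of the transition matrix. The states `⟨↓, σ⟩` and `⟨↯⟩` are absorbing. -/
noncomputable def State.step {V : Type*} : State V → PMF (State V)
  | .run P σ => P.step σ
  | .term σ => PMF.pure (.term σ)
  | .fail => PMF.pure .fail

instance {V : Type*} : MeasurableSpace (State V) := ⊤

/-- The transition matrix as a Markov kernel on the discrete space of states. -/
noncomputable def stepKernel (V : Type*) : Kernel (State V) (State V) where
  toFun s := s.step.toMeasure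
  measurable' := measurable_from_top

instance {V : Type*} : IsMarkovKernel (stepKernel V) :=
  ⟨fun s => inferInstanceAs (IsProbabilityMeasure s.step.toMeasure)⟩

/-- The initial (sub-)distribution: `⟨P, σ⟩` has the weight of `σ` in the behavior of `A`. -/
noncomputable def initial {V : Type*} (A : WAut (FPS V)) (P : Prog V) : Measure (State V) :=
  Measure.sum fun σ : Val V => A.coeff σ • Measure.dirac (State.run P σ)

/-- The measure on the infinite runs of the operational Markov chain of `P` with prior `A`. -/
noncomputable def pathMeasure {V : Type*} (A : WAut (FPS V)) (P : Prog V) :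
    Measure (ℕ → State V) :=
  Kernel.trajMeasure (X := fun _ => State V) (initial A P) fun n =>
    (stepKernel V).comap (fun h : (i : Finset.Iic n) → State V => h ⟨n, Finset.mem_Iic.2 le_rfl⟩)
      (measurable_pi_apply _)

/-- The event `◇ s` that the state `s` is eventually reached. -/
def eventually {V : Type*} (s : State V) : Set (ℕ → State V) := {ω | ∃ n, ω n = s}

end ReDiP

/-! Operational chain and automata transformer are both compared with a third semantics, `Prog.den`,
which assigns to each valuation the distribution of outcomes (a final valuation, or `none` for a
failed observation). Both sides of claim 1 equal the average of `P.den τ (some σ)` over `τ` weighted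
by the prior.

On the operational side, `den` is harmonic for the chain (`State.step_bind_den`), so its integral
along a run is constant in time (`lintegral_den`). Programs are loop-free, hence after `P.size`
steps almost every run sits in an absorbing state, where `den` is a point mass. The constant
integral is therefore the reachability probability (`pathMeasure_eventually`).

On the automata side, a behavior is `∑ s, I s * v s` with `v` the least solution of `v = F + M v`
(`sol_eq`, `sol_le`, `WAut.behavior_eq`), and each construction becomes a manipulation of linear
systems. Unions and concatenations are block-triangular systems. Substitutions are continuous
semiring homomorphisms `FPS.push`, which commute with least solutions; constant initial and final
weights are fixed by them, which is what normalization provides. Products with guard automata select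
coefficients because those automata only count letters, so the state reached depends on the monomial
and not on the order of reading. Decrement rests on a product rule for removing one letter `X`,
which is the transition structure of `decrPos`. Induction on the program gives `Prog.coeff_trans`.

Since `P.den τ` has total mass one, prior mass splits into terminated and failed mass
(`Prog.mass_trans_add`); this gives claim 2. Claim 3 follows because termination and failure are
almost surely disjoint, so conditioning on no failure only rescales by the terminated mass. -/

namespace ReDiP

/-! ### Trajectories with an s-finite initial measure -/

section Trajectory

variable {X : ℕ → Type*} [∀ n, MeasurableSpace (X n)]

theorem exists_trajMeasure_eq (μ₀ : Measure (X 0))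
    (κ : (n : ℕ) → Kernel ((i : Finset.Iic n) → X i) (X (n + 1))) [∀ n, IsMarkovKernel (κ n)] :
    ∃ f : X 0 → (i : Finset.Iic 0) → X i, Measurable f ∧
      (∀ x, f x ⟨0, Finset.mem_Iic.2 le_rfl⟩ = x) ∧
      Kernel.trajMeasure μ₀ κ = Kernel.traj κ 0 ∘ₘ μ₀.map f := by
  let e := MeasurableEquiv.piUnique fun i : Finset.Iic 0 => X i
  have h1 : Measurable (e.symm : X 0 → _) := e.symm.measurable
  have h2 (x : X 0) : (e.symm x : (i : Finset.Iic 0) → X i) ⟨0, Finset.mem_Iic.2 le_rfl⟩ = x :=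
    e.apply_symm_apply x
  refine ⟨(e.symm : X 0 → _), h1, h2, ?_⟩
  unfold Kernel.trajMeasure
  rfl

instance sFinite_trajMeasure (μ₀ : Measure (X 0)) [SFinite μ₀]
    (κ : (n : ℕ) → Kernel ((i : Finset.Iic n) → X i) (X (n + 1))) [∀ n, IsMarkovKernel (κ n)] :
    SFinite (Kernel.trajMeasure μ₀ κ) := by
  obtain ⟨f, -, -, h⟩ := exists_trajMeasure_eq μ₀ κ
  rw [h]
  infer_instance

/-- The joint law of the past and of the next state under `Kernel.trajMeasure`. -/
theorem map_frestrictLe_trajMeasure_compProd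
    (μ₀ : Measure (X 0)) [SFinite μ₀]
    (κ : (n : ℕ) → Kernel ((i : Finset.Iic n) → X i) (X (n + 1))) [∀ n, IsMarkovKernel (κ n)]
    (a : ℕ) :
    (Kernel.trajMeasure μ₀ κ).map (Preorder.frestrictLe a) ⊗ₘ κ a =
      (Kernel.trajMeasure μ₀ κ).map (fun x ↦ (Preorder.frestrictLe a x, x (a + 1))) := by
  rw [Measure.compProd_eq_comp_prod, Kernel.trajMeasure, Measure.map_comp _ _ (by fun_prop),
    Kernel.traj_map_frestrictLe, Measure.comp_assoc, Measure.map_comp _ _ (by fun_prop)]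
  congr with x₀ : 1
  rw [Kernel.comp_apply, ← Measure.compProd_eq_comp_prod, Kernel.map_apply _ (by fun_prop),
    Kernel.partialTraj_compProd_eq_map_traj (Nat.zero_le _)]

theorem map_zero_trajMeasure (μ₀ : Measure (X 0))
    (κ : (n : ℕ) → Kernel ((i : Finset.Iic n) → X i) (X (n + 1))) [∀ n, IsMarkovKernel (κ n)] :
    (Kernel.trajMeasure μ₀ κ).map (fun ω => ω 0) = μ₀ := by
  obtain ⟨f, hf, hf0, h⟩ := exists_trajMeasure_eq μ₀ κ
  have hm : Measurable fun y : (i : Finset.Iic 0) → X i => y ⟨0, Finset.mem_Iic.2 le_rfl⟩ := by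
    fun_prop
  have hc : (fun ω : (n : ℕ) → X n => ω 0) =
      (fun y : (i : Finset.Iic 0) → X i => y ⟨0, Finset.mem_Iic.2 le_rfl⟩) ∘
        Preorder.frestrictLe 0 := rfl
  rw [hc, ← Measure.map_map hm (by fun_prop), h, Measure.map_comp _ _ (by fun_prop),
    Kernel.traj_map_frestrictLe, Kernel.partialTraj_self, Measure.id_comp, Measure.map_map hm hf]
  exact (congrArg μ₀.map (funext hf0)).trans Measure.map_id

end Trajectory

/-! ### The operational semantics -/

variable {V : Type*}

instance sFinite_initial [Finite V] (A : WAut (FPS V)) (P : Prog V) : SFinite (initial A P) := by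
  unfold initial
  infer_instance

instance sFinite_pathMeasure [Finite V] (A : WAut (FPS V)) (P : Prog V) :
    SFinite (pathMeasure A P) := by
  unfold pathMeasure
  infer_instance

instance : DiscreteMeasurableSpace (State V) := ⟨fun _ => MeasurableSpace.measurableSet_top⟩

/-- The one-step Markov property, tested on products: integrate against the joint law of the past
and the next state. -/
theorem lintegral_pathMeasure_succ [Finite V] (A : WAut (FPS V)) (P : Prog V) (n : ℕ)
    (f g : State V → ℝ≥0∞) :
    ∫⁻ ω, f (ω n) * g (ω (n + 1)) ∂pathMeasure A P =
      ∫⁻ ω, f (ω n) * ∫⁻ s, g s ∂(ω n).step.toMeasure ∂pathMeasure A P := by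
  have hf : Measurable f := Measurable.of_discrete
  have hg : Measurable g := Measurable.of_discrete
  have hi : Measurable fun s : State V => ∫⁻ t, g t ∂s.step.toMeasure := Measurable.of_discrete
  have key := congrArg (fun ν => ∫⁻ x, f (x.1 ⟨n, Finset.mem_Iic.2 le_rfl⟩) * g x.2 ∂ν)
    (map_frestrictLe_trajMeasure_compProd (X := fun _ => State V) (initial A P) (fun n =>
    (stepKernel V).comap (fun h : (i : Finset.Iic n) → State V => h ⟨n, Finset.mem_Iic.2 le_rfl⟩)
      (measurable_pi_apply _)) n)
  beta_reduce at key
  rw [Measure.lintegral_compProd (by fun_prop), lintegral_map _ (by fun_prop),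
    lintegral_map (by fun_prop) (by fun_prop)] at key
  · refine key.symm.trans ?_
    refine lintegral_congr fun ω => ?_
    exact lintegral_const_mul (μ := (ω n).step.toMeasure) (f (ω n)) hg
  · fun_prop

theorem lintegral_pathMeasure_zero (A : WAut (FPS V)) (P : Prog V) (f : State V → ℝ≥0∞) :
    ∫⁻ ω, f (ω 0) ∂pathMeasure A P = ∑' σ, A.coeff σ * f (.run P σ) := by
  have hf : Measurable f := Measurable.of_discrete
  rw [← lintegral_map (f := f) (g := fun ω : ℕ → State V => ω 0) hf (by fun_prop)]
  unfold pathMeasure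
  rw [map_zero_trajMeasure (X := fun _ => State V), initial, lintegral_sum_measure]
  simp only [lintegral_smul_measure, lintegral_dirac' _ hf, smul_eq_mul]

/-- The state space may be uncountable, since programs contain real parameters. A `PMF` is
nevertheless a sum of weighted Dirac measures, and the integral follows termwise. -/
theorem lintegral_toMeasure_top {α : Type*} [MeasurableSpace α] (p : PMF α) {f : α → ℝ≥0∞}
    (hf : Measurable f) : ∫⁻ a, f a ∂p.toMeasure = ∑' a, p a * f a := by
  have h : p.toMeasure = Measure.sum fun a => p a • Measure.dirac a := by
    ext s hs
    rw [PMF.toMeasure_apply _ hs, Measure.sum_apply _ hs]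
    refine tsum_congr fun a => ?_
    rw [Measure.smul_apply, Measure.dirac_apply' _ hs, smul_eq_mul]
    by_cases ha : a ∈ s <;> simp [ha]
  rw [h, lintegral_sum_measure]
  exact tsum_congr fun a => by rw [lintegral_smul_measure, lintegral_dirac' _ hf, smul_eq_mul]

open Classical in
/-- The distribution of the final valuation of a program; `none` is a failed observation. -/
noncomputable def Prog.den : Prog V → Val V → PMF (Option (Val V))
  | .choice P₁ p P₂, σ => (coin p).bind fun b => if b then P₁.den σ else P₂.den σ
  | .ite φ P₁ P₂, σ => if φ.Sat σ then P₁.den σ else P₂.den σ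
  | .observe φ, σ => PMF.pure (if φ.Sat σ then some σ else none)
  | .seq P₁ P₂, σ => (P₁.den σ).bind fun o => o.elim (PMF.pure none) P₂.den
  | .setZero X, σ => PMF.pure (some (σ.update X 0))
  | .incrConst X n, σ => PMF.pure (some (σ.update X (σ X + n)))
  | .incrSample X D _, σ => D.map fun n => some (σ.update X (σ X + n))
  | .incrVar X Y, σ => PMF.pure (some (σ.update X (σ X + σ Y)))
  | .decr X, σ => PMF.pure (some (σ.update X (σ X - 1)))

/-- The distribution of the terminal state reached from a given state. -/
noncomputable def State.den : State V → PMF (Option (Val V))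
  | .run P σ => P.den σ
  | .term σ => PMF.pure (some σ)
  | .fail => PMF.pure none

/-- The terminal state of an outcome. -/
def State.ofOutcome : Option (Val V) → State V
  | some σ => .term σ
  | none => .fail

/-- An upper bound on the number of steps of a program. -/
def Prog.size : Prog V → ℕ
  | .choice P₁ _ P₂ => P₁.size + P₂.size + 1
  | .ite _ P₁ P₂ => P₁.size + P₂.size + 1
  | .seq P₁ P₂ => P₁.size + P₂.size
  | _ => 1

theorem Prog.size_pos (P : Prog V) : 0 < P.size := by
  induction P <;> simp only [Prog.size] <;> omega

/-- An upper bound on the number of steps to a terminal state. -/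
def State.rank : State V → ℕ
  | .run P _ => P.size
  | .term _ => 0
  | .fail => 0

theorem State.den_andThen (P₂ : Prog V) (s : State V) :
    (s.andThen P₂).den = s.den.bind fun o => o.elim (PMF.pure none) P₂.den := by
  cases s <;> simp [State.andThen, State.den, Prog.den]

/-- Handing over to `P₂` costs no step of its own: `andThen` turns a terminated state directly into
a start of `P₂`. Hence the size of a sequence has no extra `+ 1`. -/
theorem State.rank_andThen_le (P₂ : Prog V) (s : State V) :
    (s.andThen P₂).rank ≤ s.rank + P₂.size := by
  cases s <;> simp [State.andThen, State.rank, Prog.size]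

/-- Harmonicity: averaging the outcome distribution over the successors reproduces it. In the
sequential case this is associativity of `bind`. -/
theorem Prog.step_bind_den (P : Prog V) (σ : Val V) : (P.step σ).bind State.den = P.den σ := by
  induction P with
  | choice P₁ p P₂ =>
    simp only [Prog.step, Prog.den, PMF.bind_map]
    congr 1
    funext b
    cases b <;> rfl
  | ite φ P₁ P₂ =>
    simp only [Prog.step, Prog.den, PMF.pure_bind]
    split_ifs <;> rfl
  | observe φ =>
    simp only [Prog.step, Prog.den, PMF.pure_bind]
    split_ifs <;> rfl
  | seq P₁ P₂ h₁ _ =>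
    simp only [Prog.step, Prog.den, PMF.bind_map]
    rw [← h₁, PMF.bind_bind]
    congr 1
    funext s
    exact State.den_andThen P₂ s
  | incrSample X D hD =>
    simp only [Prog.step, Prog.den, PMF.bind_map]
    rfl
  | _ => simp only [Prog.step, Prog.den, PMF.pure_bind, State.den]

theorem State.step_bind_den (s : State V) : s.step.bind State.den = s.den := by
  cases s with
  | run P σ => exact P.step_bind_den σ
  | term σ => exact PMF.pure_bind _ _
  | fail => exact PMF.pure_bind _ _

/-- Loop-freeness enters here: every rule uses up a piece of syntax. -/
theorem Prog.rank_lt_size (P : Prog V) (σ : Val V) :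
    ∀ s ∈ (P.step σ).support, s.rank < P.size := by
  induction P with
  | choice P₁ p P₂ =>
    simp only [Prog.step, PMF.support_map, Set.mem_image, forall_exists_index, and_imp]
    rintro _ b - rfl
    cases b <;> simp [State.rank, Prog.size]
  | ite φ P₁ P₂ =>
    simp only [Prog.step, PMF.support_pure, Set.mem_singleton_iff, forall_eq]
    split_ifs <;> simp [State.rank, Prog.size]
  | observe φ =>
    simp only [Prog.step, PMF.support_pure, Set.mem_singleton_iff, forall_eq]
    split_ifs <;> simp [State.rank, Prog.size]
  | seq P₁ P₂ h₁ _ =>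
    simp only [Prog.step, PMF.support_map, Set.mem_image, forall_exists_index, and_imp]
    rintro _ s hs rfl
    have := h₁ s hs
    have := State.rank_andThen_le P₂ s
    simp only [Prog.size]
    omega
  | incrSample X D hD =>
    simp only [Prog.step, PMF.support_map, Set.mem_image, forall_exists_index, and_imp]
    rintro _ n - rfl
    simp [State.rank, Prog.size]
  | _ => simp [Prog.step, State.rank, Prog.size]

theorem State.exists_eq_ofOutcome {s : State V} (h : s.rank = 0) : ∃ o, s = State.ofOutcome o := by
  cases s with
  | run P σ => exact absurd h P.size_pos.ne'
  | term σ => exact ⟨some σ, rfl⟩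
  | fail => exact ⟨none, rfl⟩

theorem State.step_ofOutcome (o : Option (Val V)) :
    (State.ofOutcome o).step = PMF.pure (State.ofOutcome o) := by
  cases o <;> rfl

theorem State.den_ofOutcome (o : Option (Val V)) : (State.ofOutcome o).den = PMF.pure o := by
  cases o <;> rfl

theorem State.ofOutcome_injective : Function.Injective (State.ofOutcome (V := V)) := by
  rintro (_ | _) (_ | _) h <;> simp_all [State.ofOutcome]

/-- Truncated subtraction lets one bound cover the absorbing states too, whose rank stays `0`. -/
theorem State.rank_le_of_mem_support (s : State V) : ∀ t ∈ s.step.support, t.rank ≤ s.rank - 1 := by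
  cases s with
  | run P σ => exact fun t ht => Nat.le_sub_one_of_lt (P.rank_lt_size σ t ht)
  | term σ => simp [State.step, State.rank]
  | fail => simp [State.step, State.rank]

theorem measurableSet_eventually (s : State V) : MeasurableSet (eventually s) := by
  have : eventually s = ⋃ n, (fun ω : ℕ → State V => ω n) ⁻¹' {s} := by
    ext; simp [eventually]
  rw [this]
  exact MeasurableSet.iUnion fun n =>
    measurableSet_preimage (measurable_pi_apply n) (MeasurableSet.of_discrete (s := {s}))

/-! ### Almost sure behavior of runs -/

section Runs

variable [Finite V] (A : WAut (FPS V)) (P : Prog V)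

/-- Transfers a support condition on single steps to almost all runs: by the Markov property the
product of the two indicators has integral zero. -/
theorem ae_not_mem_succ (n : ℕ) (B C : Set (State V))
    (h : ∀ s ∈ B, ∀ t ∈ s.step.support, t ∉ C) :
    ∀ᵐ ω ∂pathMeasure A P, ω n ∈ B → ω (n + 1) ∉ C := by
  have key := lintegral_pathMeasure_succ A P n (B.indicator 1) (C.indicator 1)
  have hz : ∀ ω : ℕ → State V, B.indicator (1 : State V → ℝ≥0∞) (ω n) *
      ∫⁻ s, C.indicator 1 s ∂(ω n).step.toMeasure = 0 := by
    intro ω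
    by_cases hB : ω n ∈ B
    · have : ∫⁻ s, C.indicator (1 : State V → ℝ≥0∞) s ∂(ω n).step.toMeasure = 0 := by
        rw [lintegral_indicator_one .of_discrete,
          PMF.toMeasure_apply_eq_zero_iff _ .of_discrete,
          Set.disjoint_left]
        exact h _ hB
      rw [this, mul_zero]
    · simp [hB]
  simp only [hz, lintegral_zero] at key
  have hm : Measurable fun ω : ℕ → State V =>
      B.indicator (1 : State V → ℝ≥0∞) (ω n) * C.indicator (1 : State V → ℝ≥0∞) (ω (n + 1)) := by
    have hB : Measurable (B.indicator (1 : State V → ℝ≥0∞)) := .of_discrete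
    have hC : Measurable (C.indicator (1 : State V → ℝ≥0∞)) := .of_discrete
    fun_prop
  rw [lintegral_eq_zero_iff hm] at key
  filter_upwards [key] with ω hω hB hC
  simp [hB, hC] at hω

theorem ae_rank_add_le : ∀ᵐ ω ∂pathMeasure A P, ∀ n, (ω n).rank ≤ P.size - n := by
  have h0 : ∀ᵐ ω ∂pathMeasure A P, (ω 0).rank ≤ P.size := by
    have key := lintegral_pathMeasure_zero A P ({s : State V | P.size < s.rank}.indicator 1)
    have : ∀ σ : Val V, {s : State V | P.size < s.rank}.indicator (1 : State V → ℝ≥0∞)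
        (.run P σ) = 0 := fun σ => by simp [State.rank]
    simp only [this, mul_zero, tsum_zero] at key
    have hm : Measurable ({s : State V | P.size < s.rank}.indicator (1 : State V → ℝ≥0∞)) :=
      .of_discrete
    rw [lintegral_eq_zero_iff (by fun_prop)] at key
    filter_upwards [key] with ω hω
    by_contra hlt
    simp [not_le.1 hlt] at hω
  -- Slicing by the value `k` of the rank leaves only countably many null sets to discard.
  have hs : ∀ᵐ ω ∂pathMeasure A P, ∀ n k : ℕ,
      ω n ∈ {s : State V | s.rank = k} → ω (n + 1) ∉ {s : State V | k - 1 < s.rank} := by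
    refine ae_all_iff.2 fun n => ae_all_iff.2 fun k => ae_not_mem_succ A P n _ _ ?_
    rintro s rfl t ht
    exact not_lt.2 (s.rank_le_of_mem_support t ht)
  filter_upwards [h0, hs] with ω h0 hs n
  induction n with
  | zero => exact h0
  | succ n ih =>
    have := not_lt.1 (hs n _ rfl)
    omega

theorem ae_absorbing (o : Option (Val V)) : ∀ᵐ ω ∂pathMeasure A P, ∀ n m : ℕ, n ≤ m →
    ω n = State.ofOutcome o → ω m = State.ofOutcome o := by
  have hs : ∀ᵐ ω ∂pathMeasure A P, ∀ n : ℕ,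
      ω n ∈ ({State.ofOutcome o} : Set (State V)) → ω (n + 1) ∉
        ({State.ofOutcome o} : Set (State V))ᶜ := by
    refine ae_all_iff.2 fun n => ae_not_mem_succ A P n _ _ ?_
    rintro s rfl t ht
    simpa [State.step_ofOutcome] using ht
  filter_upwards [hs] with ω hs n m hnm hn
  induction m, hnm using Nat.le_induction with
  | base => exact hn
  | succ m _ ih => simpa using hs m ih

/-- At time `P.size` the rank is zero, so the run is already absorbed and the reachability event
depends on that one coordinate. -/
theorem ae_mem_eventually_iff (o : Option (Val V)) : ∀ᵐ ω ∂pathMeasure A P,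
    ω ∈ eventually (State.ofOutcome o) ↔ ω P.size = State.ofOutcome o := by
  -- Absorption is needed for all outcomes at once, as the outcome `o'` found at time `P.size`
  -- depends on the run. There are countably many outcomes because `V` is finite.
  filter_upwards [ae_rank_add_le A P, ae_all_iff.2 fun o => ae_absorbing A P o] with ω hr ha
  refine ⟨fun ⟨n, hn⟩ => ?_, fun h => ⟨_, h⟩⟩
  rcases le_total n P.size with h | h
  · exact ha o n _ h hn
  · obtain ⟨o', ho'⟩ := State.exists_eq_ofOutcome (Nat.le_zero.1 ((hr P.size).trans (by simp)))
    rw [ho', ← ha o' _ n h ho', hn]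

/-- A harmonic function has constant expectation along the chain. -/
theorem lintegral_den (o : Option (Val V)) (n : ℕ) :
    ∫⁻ ω, (ω n).den o ∂pathMeasure A P = ∑' τ, A.coeff τ * P.den τ o := by
  induction n with
  | zero => exact lintegral_pathMeasure_zero A P fun s => s.den o
  | succ n ih =>
    rw [← ih]
    have key := lintegral_pathMeasure_succ A P n 1 fun s => s.den o
    simp only [Pi.one_apply, one_mul] at key
    rw [key]
    refine lintegral_congr fun ω => ?_
    rw [lintegral_toMeasure_top _ Measurable.of_discrete, ← PMF.bind_apply, State.step_bind_den]

/-- Stopping at the deterministic time `P.size`: there `den` at `o` is the indicator of having been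
absorbed in `o`. -/
theorem pathMeasure_eventually (o : Option (Val V)) :
    pathMeasure A P (eventually (State.ofOutcome o)) = ∑' τ, A.coeff τ * P.den τ o := by
  classical
  rw [← lintegral_den A P o P.size]
  have hm : MeasurableSet ((fun ω : ℕ → State V => ω P.size) ⁻¹' {State.ofOutcome o}) :=
    measurable_pi_apply _ .of_discrete
  change MeasurableSet {ω : ℕ → State V | ω P.size = State.ofOutcome o} at hm
  rw [measure_congr (t := {ω : ℕ → State V | ω P.size = State.ofOutcome o})
    (Filter.eventuallyEq_set.2 (ae_mem_eventually_iff A P o)), ← lintegral_indicator_one hm]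
  refine lintegral_congr_ae ?_
  filter_upwards [ae_rank_add_le A P] with ω hr
  obtain ⟨o', ho'⟩ := State.exists_eq_ofOutcome (Nat.le_zero.1 ((hr P.size).trans (by simp)))
  rw [ho', State.den_ofOutcome, PMF.pure_apply, Set.indicator_apply]
  simp [ho', State.ofOutcome_injective.eq_iff, eq_comm]

theorem ae_not_mem_eventually_inter {o o' : Option (Val V)} (h : o ≠ o') :
    ∀ᵐ ω ∂pathMeasure A P,
      ω ∈ eventually (State.ofOutcome o) → ω ∉ eventually (State.ofOutcome o') := by
  filter_upwards [ae_mem_eventually_iff A P o, ae_mem_eventually_iff A P o'] with ω h1 h2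
  rw [h1, h2]
  exact fun h3 h4 => h (State.ofOutcome_injective (h3.symm.trans h4))

end Runs

/-! ### Power series with coefficients in `[0, ∞]` as a complete semiring -/

namespace FPS

open MvPowerSeries

instance : PartialOrder (FPS V) := inferInstanceAs (PartialOrder (Val V → ℝ≥0∞))

theorem le_def {f g : FPS V} : f ≤ g ↔ ∀ σ, coeff σ f ≤ coeff σ g := Iff.rfl

instance : IsOrderedAddMonoid (FPS V) where
  add_le_add_left f g h k σ := by
    exact add_le_add_left (h σ) _

instance : MulLeftMono (FPS V) where
  elim f g h hgh := by
    classical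
    refine le_def.2 fun σ => ?_
    rw [coeff_mul, coeff_mul]
    gcongr
    exact le_def.1 hgh _

theorem zero_le' (f : FPS V) : 0 ≤ f := le_def.2 fun _ => bot_le

/-- The coefficientwise infinite sum. -/
noncomputable def tsum (g : ℕ → FPS V) : FPS V := FPS.mk fun σ => ∑' n, coeff σ (g n)

theorem coeff_tsum (g : ℕ → FPS V) (σ : Val V) : coeff σ (tsum g) = ∑' n, coeff σ (g n) := rfl

theorem mul_tsum (f : FPS V) (g : ℕ → FPS V) : f * tsum g = tsum fun n => f * g n := by
  classical
  ext σ
  simp only [coeff_mul, coeff_tsum, ← ENNReal.tsum_mul_left]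
  exact (Summable.tsum_finsetSum fun _ _ => ENNReal.summable).symm

theorem tsum_mul (f : FPS V) (g : ℕ → FPS V) : tsum g * f = tsum fun n => g n * f := by
  simp only [mul_comm _ f, mul_tsum]

theorem sum_tsum {ι : Type*} (s : Finset ι) (g : ι → ℕ → FPS V) :
    ∑ i ∈ s, tsum (g i) = tsum fun n => ∑ i ∈ s, g i n := by
  ext σ
  simp only [map_sum, coeff_tsum]
  exact (Summable.tsum_finsetSum fun _ _ => ENNReal.summable).symm

theorem tsum_eq_zero_add (g : ℕ → FPS V) : tsum g = g 0 + tsum fun n => g (n + 1) := by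
  ext σ
  simp only [map_add, coeff_tsum]
  exact tsum_eq_zero_add' ENNReal.summable

theorem tsum_le {g : ℕ → FPS V} {f : FPS V} (h : ∀ N, ∑ n ∈ Finset.range N, g n ≤ f) :
    tsum g ≤ f := by
  refine le_def.2 fun σ => ENNReal.tsum_le_of_sum_range_le fun N => ?_
  rw [← map_sum]
  exact le_def.1 (h N) σ

/-- The sum of the values of a function, weighted by the coefficients of a series. -/
noncomputable def pair (f : FPS V) (φ : Val V → ℝ≥0∞) : ℝ≥0∞ := ∑' σ, coeff σ f * φ σ

theorem pair_add (f g : FPS V) (φ : Val V → ℝ≥0∞) : pair (f + g) φ = pair f φ + pair g φ := by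
  simp only [pair, map_add, add_mul, ENNReal.tsum_add]

open Classical in
theorem coeff_eq_pair (f : FPS V) (σ : Val V) :
    coeff σ f = pair f fun τ => if τ = σ then 1 else 0 := by
  simp [pair]

/-- The Cauchy product is a convolution: regroup the double sum over all pairs of monomials along
their sum. Tests by `pair` thereby avoid antidiagonals later. -/
theorem pair_mul (f g : FPS V) (φ : Val V → ℝ≥0∞) :
    pair (f * g) φ = pair f fun σ => pair g fun τ => φ (σ + τ) := by
  classical
  simp only [pair, coeff_mul, Finset.sum_mul]
  have h (σ : Val V) : ∑ p ∈ Finset.HasAntidiagonal.antidiagonal σ,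
      coeff p.1 f * coeff p.2 g * φ σ =
      ∑' q : Finset.HasAntidiagonal.antidiagonal σ,
        coeff q.1.1 f * coeff q.1.2 g * φ (q.1.1 + q.1.2) := by
    rw [← Finset.tsum_subtype]
    refine tsum_congr fun q => ?_
    rw [Finset.HasAntidiagonal.mem_antidiagonal.1 q.2]
  simp only [h]
  rw [← ENNReal.tsum_sigma' (f := fun q : (Σ σ : Val V, Finset.HasAntidiagonal.antidiagonal σ) =>
      coeff q.2.1.1 f * coeff q.2.1.2 g * φ (q.2.1.1 + q.2.1.2))]
  simp only [← ENNReal.tsum_mul_left]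
  rw [← ENNReal.tsum_prod (f := fun σ τ => coeff σ f * (coeff τ g * φ (σ + τ)))]
  rw [← Finset.HasAntidiagonal.sigmaAntidiagonalEquivProd.tsum_eq]
  exact tsum_congr fun q => by simp [mul_assoc]

open Classical in
/-- The linear map that sends a monomial `σ` to `w σ • g σ`. -/
noncomputable def pushFun (w : Val V → ℝ≥0∞) (g : Val V → Val V) (f : FPS V) : FPS V :=
  FPS.mk fun σ => pair f fun τ => if g τ = σ then w τ else 0

theorem pair_pushFun (w : Val V → ℝ≥0∞) (g : Val V → Val V) (f : FPS V) (φ : Val V → ℝ≥0∞) :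
    pair (pushFun w g f) φ = pair f fun τ => w τ * φ (g τ) := by
  classical
  simp only [pair, pushFun, coeff_mk, ← ENNReal.tsum_mul_right]
  rw [ENNReal.tsum_comm]
  refine tsum_congr fun τ => ?_
  rw [tsum_eq_single (g τ) fun σ h => by simp [h.symm]]
  simp [mul_assoc]

theorem ext_pair {f g : FPS V} (h : ∀ φ, pair f φ = pair g φ) : f = g := by
  classical
  ext σ
  rw [coeff_eq_pair, coeff_eq_pair, h]

/-- The weighted substitution homomorphism that sends a monomial `σ` to `w σ • g σ`. -/
noncomputable def push (w : Multiplicative (Val V) →* ℝ≥0∞) (g : Val V →+ Val V) :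
    FPS V →+* FPS V where
  toFun := pushFun (fun τ => w (.ofAdd τ)) g
  map_zero' := by
    ext σ
    simp [pushFun, coeff_mk, pair]
  map_one' := by
    classical
    ext σ
    rw [pushFun, coeff_mk, pair, tsum_eq_single 0 fun τ h => by simp [coeff_one, h]]
    simp [coeff_one, eq_comm]
  map_add' f h := by
    ext σ
    simp [pushFun, coeff_mk, pair_add]
  map_mul' f h := by
    -- Both sides become double sums over pairs of monomials, whose terms agree as `w` is
    -- multiplicative and `g` additive. Infinite fibers of `g` are harmless with coefficients in
    -- `[0, ∞]`.
    refine ext_pair fun φ => ?_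
    simp only [pair_pushFun, pair_mul, ofAdd_add, map_mul, map_add]
    simp only [pair, ← ENNReal.tsum_mul_left]
    refine tsum_congr fun σ => tsum_congr fun τ => ?_
    ring

open Classical in
theorem coeff_push (w : Multiplicative (Val V) →* ℝ≥0∞) (g : Val V →+ Val V) (f : FPS V)
    (σ : Val V) :
    coeff σ (push w g f) = ∑' τ, coeff τ f * if g τ = σ then w (.ofAdd τ) else 0 := rfl

theorem push_tsum (w : Multiplicative (Val V) →* ℝ≥0∞) (g : Val V →+ Val V) (f : ℕ → FPS V) :
    push w g (tsum f) = tsum fun n => push w g (f n) := by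
  classical
  ext σ
  simp only [coeff_push, coeff_tsum, ← ENNReal.tsum_mul_right]
  exact ENNReal.tsum_comm

end FPS

/-! ### Least solutions of linear systems -/

section LinearSystem

open MvPowerSeries

variable {Q : Type*} [Fintype Q]

/-- `Mⁿ F`. -/
noncomputable def layer (M : Matrix Q Q (FPS V)) (F : Q → FPS V) : ℕ → Q → FPS V
  | 0 => F
  | n + 1 => fun s => ∑ t, M s t * layer M F n t

/-- `M^* F`, the least solution of `v = F + M v`. -/
noncomputable def sol (M : Matrix Q Q (FPS V)) (F : Q → FPS V) (s : Q) : FPS V :=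
  FPS.tsum fun n => layer M F n s

theorem sol_eq (M : Matrix Q Q (FPS V)) (F : Q → FPS V) (s : Q) :
    sol M F s = F s + ∑ t, M s t * sol M F t := by
  simp only [sol, FPS.mul_tsum, FPS.sum_tsum]
  exact FPS.tsum_eq_zero_add _

/-- Kleene iteration: by induction every partial sum of `∑ Mⁿ F` stays below any `v` with `F + M v ≤
v`. Equalities of solutions are proved below by two such comparisons. -/
theorem sol_le {M : Matrix Q Q (FPS V)} {F v : Q → FPS V}
    (h : ∀ s, F s + ∑ t, M s t * v t ≤ v s) (s : Q) : sol M F s ≤ v s := by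
  refine FPS.tsum_le fun N => ?_
  induction N generalizing s with
  | zero => exact FPS.zero_le' _
  | succ N ih =>
    rw [Finset.sum_range_succ']
    simp only [layer]
    rw [Finset.sum_comm, add_comm]
    refine le_trans (add_le_add_right (Finset.sum_le_sum fun t _ => ?_) _) (h s)
    rw [← Finset.mul_sum]
    exact mul_le_mul_right (ih t) _

theorem layer_mul (M : Matrix Q Q (FPS V)) (F : Q → FPS V) (f : FPS V) (n : ℕ) (s : Q) :
    layer M (fun t => F t * f) n s = layer M F n s * f := by
  induction n generalizing s with
  | zero => rfl
  | succ n ih => simp only [layer, ih, Finset.sum_mul, mul_assoc]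

theorem sol_mul (M : Matrix Q Q (FPS V)) (F : Q → FPS V) (f : FPS V) (s : Q) :
    sol M (fun t => F t * f) s = sol M F s * f := by
  simp only [sol, layer_mul, FPS.tsum_mul]

theorem layer_push (w : Multiplicative (Val V) →* ℝ≥0∞) (g : Val V →+ Val V)
    (M : Matrix Q Q (FPS V)) (F : Q → FPS V) (n : ℕ) (s : Q) :
    layer (M.map (FPS.push w g)) (fun t => FPS.push w g (F t)) n s =
      FPS.push w g (layer M F n s) := by
  induction n generalizing s with
  | zero => rfl
  | succ n ih => simp only [layer, ih, map_sum, map_mul, Matrix.map_apply]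

/-- A semiring homomorphism that respects infinite sums commutes with forming the least solution. -/
theorem sol_push (w : Multiplicative (Val V) →* ℝ≥0∞) (g : Val V →+ Val V)
    (M : Matrix Q Q (FPS V)) (F : Q → FPS V) (s : Q) :
    sol (M.map (FPS.push w g)) (fun t => FPS.push w g (F t)) s = FPS.push w g (sol M F s) := by
  simp only [sol, layer_push, FPS.push_tsum]

open Classical in
theorem layer_eq_pow_mulVec (M : Matrix Q Q (FPS V)) (F : Q → FPS V) (n : ℕ) (s : Q) :
    layer M F n s = ∑ t, (M ^ n) s t * F t := by
  induction n generalizing s with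
  | zero => simp [layer, Matrix.one_apply]
  | succ n ih =>
    simp only [layer, ih, pow_succ', Matrix.mul_apply, Finset.mul_sum, Finset.sum_mul, mul_assoc]
    exact Finset.sum_comm

theorem WAut.behavior_eq (A : WAut (FPS V)) :
    A.behavior = ∑ s, A.I s * sol A.M A.F s := by
  classical
  unfold WAut.behavior
  refine Finset.sum_congr rfl fun s _ => ?_
  simp only [mul_assoc, ← Finset.mul_sum]
  congr 1
  simp only [sol, layer_eq_pow_mulVec, ← FPS.sum_tsum, ← FPS.tsum_mul]
  rfl

end LinearSystem

/-! ### Labels -/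

namespace FPS

open MvPowerSeries

/-- Series of the form `r + ∑ X, r_X X`. -/
def IsLinear (f : FPS V) : Prop :=
  ∀ σ, coeff σ f ≠ 0 → σ = 0 ∨ ∃ X, σ = Finsupp.single X 1

/-- Constant series. -/
def IsConst (f : FPS V) : Prop := ∀ σ, coeff σ f ≠ 0 → σ = 0

theorem isConst_C (r : ℝ≥0∞) : IsConst (C r : FPS V) := by
  classical
  intro σ h
  by_contra h0
  simp [coeff_C, h0] at h

theorem IsConst.eq_C {f : FPS V} (h : IsConst f) : f = C (coeff 0 f) := by
  classical
  ext σ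
  rw [coeff_C]
  split_ifs with h0
  · rw [h0]
  · exact not_not.1 fun hf => h0 (h σ hf)

theorem IsConst.isLinear {f : FPS V} (h : IsConst f) : IsLinear f := fun σ hσ => .inl (h σ hσ)

theorem isConst_zero : IsConst (0 : FPS V) := by simpa using isConst_C (V := V) 0

theorem isConst_one : IsConst (1 : FPS V) := by simpa using isConst_C (V := V) 1

theorem IsConst.mul {f g : FPS V} (hf : IsConst f) (hg : IsConst g) : IsConst (f * g) := by
  rw [hf.eq_C, hg.eq_C, ← map_mul]
  exact isConst_C _

theorem IsLinear.add {f g : FPS V} (hf : IsLinear f) (hg : IsLinear g) : IsLinear (f + g) := by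
  intro σ h
  by_cases h0 : coeff σ f = 0
  · refine hg σ fun h1 => h ?_
    rw [map_add, h0, h1, add_zero]
  · exact hf σ h0

theorem isLinear_X (X : V) : IsLinear (MvPowerSeries.X X : FPS V) := by
  classical
  intro σ h
  rw [coeff_X] at h
  exact .inr ⟨X, by simpa using h⟩

theorem IsLinear.of_coeff {f g : FPS V} (hf : IsLinear f)
    (h : ∀ σ, coeff σ f = 0 → coeff σ g = 0) : IsLinear g :=
  fun σ hσ => hf σ fun h0 => hσ (h σ h0)

theorem _root_.ReDiP.WAut.IsLabel.isLinear {f : FPS V} (h : WAut.IsLabel f) : IsLinear f := by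
  obtain ⟨r, rfl | ⟨X, rfl⟩⟩ := h
  · exact (isConst_C _).isLinear
  · refine (isLinear_X X).of_coeff fun σ h => ?_
    rw [coeff_C_mul, h, mul_zero]

theorem coeff_dropLetter [DecidableEq V] (X : V) (f : FPS V) (σ : Val V) :
    coeff σ (WAut.dropLetter X f) = if σ = Finsupp.single X 1 then 0 else coeff σ f := by
  rw [WAut.dropLetter, coeff_mk]
  congr

theorem IsLinear.dropLetter {f : FPS V} (hf : IsLinear f) (X : V) :
    IsLinear (WAut.dropLetter X f) := by
  classical
  refine hf.of_coeff fun σ h => ?_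
  rw [coeff_dropLetter, h, ite_self]

theorem dropLetter_add (X : V) (f : FPS V) :
    f = WAut.dropLetter X f + C (WAut.letterWeight X f) * MvPowerSeries.X X := by
  classical
  ext σ
  rw [map_add, coeff_dropLetter, coeff_C_mul, coeff_X, WAut.letterWeight]
  split_ifs with h <;> simp [h]

theorem IsLinear.substLabel {f : FPS V} (hf : IsLinear f) (X : V) (i : ℝ≥0∞) :
    IsLinear (WAut.substLabel X i f) :=
  (hf.dropLetter X).add (isConst_C _).isLinear

theorem IsLinear.coeff_dropLetter_eq_zero {f : FPS V} (hf : IsLinear f) {X : V} {σ : Val V}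
    (hσ : σ X ≠ 0) : coeff σ (WAut.dropLetter X f) = 0 := by
  classical
  rw [coeff_dropLetter]
  split_ifs with h
  · rfl
  · by_contra h0
    obtain rfl | ⟨Y, rfl⟩ := hf σ h0
    · exact hσ rfl
    · obtain rfl : Y = X := by
        by_contra hne
        exact hσ (Finsupp.single_eq_of_ne (Ne.symm hne))
      exact h rfl

end FPS

/-! ### Block-triangular linear systems -/

section Blocks

variable {Q R : Type*} [Fintype Q] [Fintype R]

theorem sol_fromBlocks_inr (M : Matrix Q Q (FPS V)) (N : Matrix Q R (FPS V))
    (L : Matrix R R (FPS V)) (F : Q → FPS V) (G : R → FPS V) (b : R) :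
    sol (Matrix.fromBlocks M N 0 L) (Sum.elim F G) (.inr b) = sol L G b := by
  have h (n : ℕ) : ∀ b, layer (Matrix.fromBlocks M N 0 L) (Sum.elim F G) n (.inr b) =
      layer L G n b := by
    induction n with
    | zero => exact fun b => rfl
    | succ n ih => simp [layer, Fintype.sum_sum_type, ih]
  simp only [sol, h]

/-- Back substitution: the lower block never returns to the upper one, so its solution can be added
to the final weights of the upper block. -/
theorem sol_fromBlocks_inl (M : Matrix Q Q (FPS V)) (N : Matrix Q R (FPS V))
    (L : Matrix R R (FPS V)) (F : Q → FPS V) (G : R → FPS V) (a : Q) :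
    sol (Matrix.fromBlocks M N 0 L) (Sum.elim F G) (.inl a) =
      sol M (fun s => F s + ∑ b, N s b * sol L G b) a := by
  refine le_antisymm ?_ ?_
  · refine sol_le (v := Sum.elim (sol M fun s => F s + ∑ b, N s b * sol L G b) (sol L G)) ?_
      (Sum.inl a)
    rintro (s | b)
    · simp only [Fintype.sum_sum_type, Sum.elim_inl, Sum.elim_inr, Matrix.fromBlocks_apply₁₁,
        Matrix.fromBlocks_apply₁₂]
      rw [sol_eq M, add_assoc, add_comm (∑ b, _)]
    · simp only [Fintype.sum_sum_type, Sum.elim_inl, Sum.elim_inr, Matrix.fromBlocks_apply₂₁,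
        Matrix.fromBlocks_apply₂₂, Matrix.zero_apply, zero_mul, Finset.sum_const_zero, zero_add]
      exact (sol_eq L G b).ge
  · refine sol_le (v := fun s => sol (Matrix.fromBlocks M N 0 L) (Sum.elim F G) (.inl s)) ?_ a
    intro s
    refine le_of_eq ?_
    conv_rhs => rw [sol_eq]
    simp only [Fintype.sum_sum_type, Sum.elim_inl, Matrix.fromBlocks_apply₁₁,
      Matrix.fromBlocks_apply₁₂, sol_fromBlocks_inr]
    rw [add_assoc, add_comm (∑ b, _)]

end Blocks

namespace WAut

open MvPowerSeries

/-- All transitions are linear, all initial and final weights are constant. -/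
structure IsSimple (A : WAut (FPS V)) : Prop where
  M : ∀ s t, FPS.IsLinear (A.M s t)
  I : ∀ s, FPS.IsConst (A.I s)
  F : ∀ s, FPS.IsConst (A.F s)

/-- `IsSimple` is the invariant of the recursion on programs. It contains no mass bound, so all
constructions preserve it without estimates, and its constant initial and final weights are what
normalization gives. -/
theorem IsPGA.isSimple {A : WAut (FPS V)} (h : A.IsPGA) (h' : A.IsNormalized) : A.IsSimple where
  M s t := (h.1 s t).isLinear
  I s σ hσ := h' s σ (.inl hσ)
  F s σ hσ := h' s σ (.inr hσ)

/-! ### Concatenation and disjoint union -/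

theorem IsSimple.concat {A B : WAut (FPS V)} (hA : A.IsSimple) (hB : B.IsSimple) :
    (A.concat B).IsSimple where
  M := by
    rintro (s | s) (t | t)
    · exact hA.M s t
    · exact ((hA.F s).mul (hB.I t)).isLinear
    · exact FPS.isConst_zero.isLinear
    · exact hB.M s t
  I := by
    rintro (s | s)
    · exact hA.I s
    · exact FPS.isConst_zero
  F := by
    rintro (s | s)
    · exact FPS.isConst_zero
    · exact hB.F s

/-- Elimination of the second block turns the final weights of `A` into `A.F s * B.behavior`, and a
common right factor of the final weights pulls out of the solution. -/
theorem behavior_concat (A B : WAut (FPS V)) :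
    (A.concat B).behavior = A.behavior * B.behavior := by
  rw [behavior_eq, behavior_eq A, Finset.sum_mul]
  change ∑ s : A.Q ⊕ B.Q, (Sum.elim A.I 0 s : FPS V) * sol (Matrix.fromBlocks A.M
    (Matrix.of fun s t => A.F s * B.I t) 0 B.M) (Sum.elim 0 B.F) s = _
  rw [Fintype.sum_sum_type]
  simp only [Sum.elim_inl, Sum.elim_inr, Pi.zero_apply, zero_mul, Finset.sum_const_zero, add_zero,
    sol_fromBlocks_inl, zero_add, Matrix.of_apply, mul_assoc]
  refine Finset.sum_congr rfl fun s _ => ?_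
  simp only [← Finset.mul_sum, ← behavior_eq, sol_mul]

theorem coeff_concat [DecidableEq V] (A B : WAut (FPS V)) (σ : Val V) :
    (A.concat B).coeff σ = ∑' τ, A.coeff τ * ∑' ρ, B.coeff ρ * if τ + ρ = σ then 1 else 0 := by
  classical
  rw [coeff, behavior_concat, FPS.coeff_eq_pair, FPS.pair_mul]
  simp only [FPS.pair]
  refine tsum_congr fun τ => ?_
  congr 1
  refine tsum_congr fun ρ => ?_
  congr

theorem IsSimple.wunion {A B : WAut (FPS V)} (hA : A.IsSimple) (hB : B.IsSimple) (p q : ℝ≥0∞) :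
    (A.wunion B p q).IsSimple where
  M := by
    rintro (s | s) (t | t)
    · exact hA.M s t
    · exact FPS.isConst_zero.isLinear
    · exact FPS.isConst_zero.isLinear
    · exact hB.M s t
  I := by
    rintro (s | s)
    · exact (FPS.isConst_C p).mul (hA.I s)
    · exact (FPS.isConst_C q).mul (hB.I s)
  F := by
    rintro (s | s)
    · exact hA.F s
    · exact hB.F s

theorem coeff_wunion (A B : WAut (FPS V)) (p q : ℝ≥0∞) (σ : Val V) :
    (A.wunion B p q).coeff σ = p * A.coeff σ + q * B.coeff σ := by
  have h : (A.wunion B p q).behavior = C p * A.behavior + C q * B.behavior := by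
    rw [behavior_eq, behavior_eq A, behavior_eq B]
    change ∑ s : A.Q ⊕ B.Q, (Sum.elim (fun s => C p * A.I s) (fun s => C q * B.I s) s : FPS V) *
      sol (Matrix.fromBlocks A.M 0 0 B.M) (Sum.elim A.F B.F) s = _
    rw [Fintype.sum_sum_type]
    simp only [Sum.elim_inl, Sum.elim_inr, sol_fromBlocks_inl, sol_fromBlocks_inr, mul_assoc,
      Finset.mul_sum, Matrix.zero_apply, zero_mul, Finset.sum_const_zero, add_zero]
  rw [coeff, h, map_add, coeff_C_mul, coeff_C_mul]
  rfl

/-- Rescaling the initial weights. -/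
theorem coeff_smul_initial (A : WAut (FPS V)) (p : ℝ≥0∞) (σ : Val V) :
    ({ A with I := fun s => C p * A.I s } : WAut (FPS V)).coeff σ = p * A.coeff σ := by
  rw [coeff, coeff, behavior_eq, behavior_eq, ← coeff_C_mul, Finset.mul_sum]
  simp only [mul_assoc]

/-! ### Substitution -/

theorem _root_.ReDiP.FPS.push_eq_self {w : Multiplicative (Val V) →* ℝ≥0∞} {g : Val V →+ Val V}
    {f : FPS V} (h : ∀ τ, MvPowerSeries.coeff τ f ≠ 0 → g τ = τ ∧ w (.ofAdd τ) = 1) :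
    FPS.push w g f = f := by
  classical
  ext σ
  rw [FPS.coeff_push, FPS.coeff_eq_pair, FPS.pair]
  refine tsum_congr fun τ => ?_
  by_cases h0 : MvPowerSeries.coeff τ f = 0
  · rw [h0, zero_mul, zero_mul]
  · rw [(h τ h0).1, (h τ h0).2]

theorem _root_.ReDiP.FPS.IsConst.push {f : FPS V} (h : FPS.IsConst f)
    (w : Multiplicative (Val V) →* ℝ≥0∞) (g : Val V →+ Val V) : FPS.push w g f = f :=
  FPS.push_eq_self fun τ hτ => by simp [h τ hτ]

theorem _root_.ReDiP.FPS.push_X (w : Multiplicative (Val V) →* ℝ≥0∞) (g : Val V →+ Val V) (X : V) :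
    FPS.push w g (MvPowerSeries.X X) =
      monomial (g (Finsupp.single X 1)) (w (.ofAdd (Finsupp.single X 1))) := by
  classical
  ext σ
  rw [FPS.coeff_push, tsum_eq_single (Finsupp.single X 1) fun τ h => by simp [coeff_X, h]]
  simp [coeff_monomial, coeff_X, eq_comm]

theorem _root_.ReDiP.FPS.IsLinear.push {f : FPS V} (hf : FPS.IsLinear f)
    {w : Multiplicative (Val V) →* ℝ≥0∞} {g : Val V →+ Val V} {X : V}
    (h : ∀ τ, τ X = 0 → g τ = τ ∧ w (.ofAdd τ) = 1) :
    FPS.push w g f = dropLetter X f + C (letterWeight X f) *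
      monomial (g (Finsupp.single X 1)) (w (.ofAdd (Finsupp.single X 1))) := by
  conv_lhs => rw [FPS.dropLetter_add X f]
  rw [map_add, map_mul, (FPS.isConst_C _).push, FPS.push_X, FPS.push_eq_self fun τ hτ => h τ ?_]
  exact not_not.1 fun h0 => hτ (hf.coeff_dropLetter_eq_zero h0)

/-- Constant initial and final weights are fixed by a substitution, so substituting in the
transitions alone substitutes in the whole behavior. -/
theorem behavior_push {A : WAut (FPS V)} (hA : A.IsSimple)
    (w : Multiplicative (Val V) →* ℝ≥0∞) (g : Val V →+ Val V) :
    ∑ s, A.I s * sol (A.M.map (FPS.push w g)) A.F s = FPS.push w g A.behavior := by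
  rw [behavior_eq, map_sum]
  refine Finset.sum_congr rfl fun s _ => ?_
  rw [map_mul, (hA.I s).push, ← sol_push]
  simp only [(hA.F _).push]

theorem IsSimple.labelSubst {A : WAut (FPS V)} (hA : A.IsSimple) (X : V) (i : ℝ≥0∞) :
    (A.labelSubst X i).IsSimple where
  M s t := (hA.M s t).substLabel X i
  I := hA.I
  F := hA.F

/-- Covers both uses: for `i = 1`, `w` is trivial and `g` erases `X`; for `i = 0`, `g` is the
identity and `w` kills the monomials containing `X`. -/
theorem behavior_labelSubst {A : WAut (FPS V)} (hA : A.IsSimple) {X : V} {i : ℝ≥0∞}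
    {w : Multiplicative (Val V) →* ℝ≥0∞} {g : Val V →+ Val V}
    (h : ∀ τ, τ X = 0 → g τ = τ ∧ w (.ofAdd τ) = 1)
    (hX : monomial (g (Finsupp.single X 1)) (w (.ofAdd (Finsupp.single X 1))) = (C i : FPS V)) :
    (A.labelSubst X i).behavior = FPS.push w g A.behavior := by
  rw [← behavior_push hA, behavior_eq]
  have hM : A.M.map (FPS.push w g) = (A.labelSubst X i).M := by
    ext1 s t
    rw [Matrix.map_apply, (hA.M s t).push h, hX, ← map_mul]
    rfl
  rw [hM]
  rfl

theorem coeff_labelSubst_one [DecidableEq V] {A : WAut (FPS V)} (hA : A.IsSimple) (X : V)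
    (σ : Val V) :
    (A.labelSubst X 1).coeff σ = ∑' τ, A.coeff τ * if τ.erase X = σ then 1 else 0 := by
  classical
  rw [coeff, behavior_labelSubst hA (w := 1) (g := Finsupp.eraseAddHom X), FPS.coeff_push]
  · refine tsum_congr fun τ => ?_
    simp only [Finsupp.eraseAddHom_apply, MonoidHom.one_apply]
    congr
  · intro τ hτ
    simp [Finsupp.erase_of_notMem_support, hτ]
  · simp

/-- The homomorphism that annihilates the monomials in which `X` occurs. -/
noncomputable def absentWeight (X : V) : Multiplicative (Val V) →* ℝ≥0∞ where
  toFun τ := if τ.toAdd X = 0 then 1 else 0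
  map_one' := by simp
  map_mul' σ τ := by
    simp only [toAdd_mul, Finsupp.add_apply, add_eq_zero]
    by_cases h : σ.toAdd X = 0 <;> simp [h]

theorem coeff_labelSubst_zero {A : WAut (FPS V)} (hA : A.IsSimple) (X : V) (σ : Val V) :
    (A.labelSubst X 0).coeff σ = if σ X = 0 then A.coeff σ else 0 := by
  classical
  rw [coeff, behavior_labelSubst hA (w := absentWeight X) (g := .id _), FPS.coeff_push,
    tsum_eq_single σ fun τ hτ => by simp [hτ]]
  · simp [absentWeight, coeff]
  · intro τ hτ
    simp [absentWeight, hτ]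
  · simp [absentWeight]

end WAut

namespace WAut

open MvPowerSeries

/-! ### Transition substitution -/

theorem IsSimple.transSubst {A B : WAut (FPS V)} (hA : A.IsSimple) (hB : B.IsSimple) (X : V) :
    (A.transSubst X B).IsSimple where
  M := by
    classical
    rintro (s | e) (t | e')
    · exact (hA.M s t).dropLetter X
    · change FPS.IsLinear (if e'.1.1 = s then _ else _)
      split_ifs
      · exact ((FPS.isConst_C _).mul (hB.I _)).isLinear
      · exact FPS.isConst_zero.isLinear
    · change FPS.IsLinear (if e.1.2 = t then _ else _)
      split_ifs
      · exact (hB.F _).isLinear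
      · exact FPS.isConst_zero.isLinear
    · change FPS.IsLinear (if e.1 = e'.1 then _ else _)
      split_ifs
      · exact hB.M _ _
      · exact FPS.isConst_zero.isLinear
  I := by
    rintro (s | e)
    · exact hA.I s
    · exact FPS.isConst_zero
  F := by
    rintro (s | e)
    · exact hA.F s
    · exact FPS.isConst_zero

-- The copy attached to `(s, t)` is entered only from `s` and left only to `t`, so eliminating it
-- multiplies `r s t` by the behavior of the copied automaton. The copies lead back to `Q`, so the
-- system is not triangular and leastness is used in both directions.
open Classical in
theorem sol_substitution {Q R : Type*} [Fintype Q] [Fintype R] (D : Matrix Q Q (FPS V))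
    (r : Q → Q → FPS V) (L : Matrix R R (FPS V)) (N G : R → FPS V) (F : Q → FPS V) (s : Q) :
    sol (Matrix.fromBlocks D
      (Matrix.of fun s (e : (Q × Q) × R) => if e.1.1 = s then r e.1.1 e.1.2 * N e.2 else 0)
      (Matrix.of fun (e : (Q × Q) × R) t => if e.1.2 = t then G e.2 else 0)
      (Matrix.of fun (e e' : (Q × Q) × R) => if e.1 = e'.1 then L e.2 e'.2 else 0))
      (Sum.elim F 0) (.inl s) =
    sol (Matrix.of fun s t => D s t + r s t * ∑ b, N b * sol L G b) F s := by
  set M' : Matrix Q Q (FPS V) := Matrix.of fun s t => D s t + r s t * ∑ b, N b * sol L G b with hM'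
  generalize hT : Matrix.fromBlocks D
      (Matrix.of fun s (e : (Q × Q) × R) => if e.1.1 = s then r e.1.1 e.1.2 * N e.2 else 0)
      (Matrix.of fun (e : (Q × Q) × R) t => if e.1.2 = t then G e.2 else 0)
      (Matrix.of fun (e e' : (Q × Q) × R) => if e.1 = e'.1 then L e.2 e'.2 else 0) = T
  -- the system restricted to the two kinds of states
  have eq_inl (v : Q ⊕ ((Q × Q) × R) → FPS V) (s : Q) :
      ∑ t, T (.inl s) t * v t =
        ∑ t, (D s t * v (.inl t) + r s t * ∑ b, N b * v (.inr ((s, t), b))) := by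
    rw [Fintype.sum_sum_type, Finset.sum_add_distrib, ← hT]
    congr 1
    rw [Fintype.sum_prod_type, Fintype.sum_prod_type, Finset.sum_eq_single s _ (by simp)]
    · refine Finset.sum_congr rfl fun t _ => ?_
      simp [Finset.mul_sum, mul_assoc]
    · intro s' _ hs'
      simp [hs']
  have eq_inr (v : Q ⊕ ((Q × Q) × R) → FPS V) (e : Q × Q) (b : R) :
      ∑ t, T (.inr (e, b)) t * v t = G b * v (.inl e.2) + ∑ b', L b b' * v (.inr (e, b')) := by
    rw [Fintype.sum_sum_type, ← hT]
    congr 1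
    · simp
    · rw [Fintype.sum_prod_type, Finset.sum_eq_single e _ (by simp)]
      · simp
      · intro e' _ he'
        simp [he'.symm]
  refine le_antisymm ?_ ?_
  · refine sol_le (v := Sum.elim (sol M' F) fun x => sol L G x.2 * sol M' F x.1.2) ?_
      (Sum.inl s)
    rintro (s | ⟨e, b⟩)
    · rw [eq_inl]
      simp only [Sum.elim_inl, Sum.elim_inr]
      rw [sol_eq M' F s]
      refine le_of_eq ?_
      congr 1
      refine Finset.sum_congr rfl fun t _ => ?_
      rw [hM', Matrix.of_apply, add_mul, mul_assoc, Finset.sum_mul]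
      simp only [mul_assoc]
    · rw [eq_inr]
      simp only [Sum.elim_inl, Sum.elim_inr, Pi.zero_apply, zero_add]
      rw [sol_eq L G b, add_mul, Finset.sum_mul]
      simp only [mul_assoc]
      exact le_rfl
  · have hr (e : Q × Q) (b : R) : sol L G b * sol T (Sum.elim F 0) (.inl e.2) ≤
        sol T (Sum.elim F 0) (.inr (e, b)) := by
      rw [← sol_mul]
      refine sol_le (v := fun b => sol T (Sum.elim F 0) (.inr (e, b))) (fun b => ?_) b
      rw [← eq_inr _ e b, sol_eq T _ (.inr (e, b))]
      simp
    refine sol_le (v := fun s => sol T (Sum.elim F 0) (.inl s)) (fun s => ?_) s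
    rw [sol_eq T _ (.inl s), eq_inl, Sum.elim_inl]
    refine add_le_add_right (Finset.sum_le_sum fun t _ => ?_) _
    rw [hM', Matrix.of_apply, add_mul, mul_assoc, Finset.sum_mul]
    refine add_le_add_right (mul_le_mul_right (Finset.sum_le_sum fun b _ => ?_) _) _
    rw [mul_assoc]
    exact mul_le_mul_right (hr (s, t) b) _

theorem behavior_transSubst (A B : WAut (FPS V)) (X : V) :
    (A.transSubst X B).behavior = ∑ s, A.I s *
      sol (Matrix.of fun s t => dropLetter X (A.M s t) +
        C (letterWeight X (A.M s t)) * B.behavior) A.F s := by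
  classical
  rw [B.behavior_eq]
  refine (behavior_eq _).trans ((Fintype.sum_sum_type _).trans ((congrArg₂ (· + ·)
    (Finset.sum_congr rfl fun s _ => congrArg (A.I s * ·) ?_)
    (Finset.sum_eq_zero fun e _ => zero_mul _)).trans (add_zero _)))
  exact sol_substitution (Matrix.of fun s t => dropLetter X (A.M s t))
    (fun s t => C (letterWeight X (A.M s t))) B.M B.I B.F A.F s

theorem behavior_twoStep (Y X : V) :
    (twoStep Y X).behavior = MvPowerSeries.X Y * MvPowerSeries.X X := by
  refine (behavior_eq _).trans ?_
  change ∑ s : Fin 3, (![1, 0, 0] s : FPS V) * sol (!![0, MvPowerSeries.X Y, 0;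
    0, 0, MvPowerSeries.X X; 0, 0, 0] : Matrix (Fin 3) (Fin 3) (FPS V)) ![0, 0, 1] s = _
  generalize hM : (!![0, MvPowerSeries.X Y, 0; 0, 0, MvPowerSeries.X X; 0, 0, 0] :
    Matrix (Fin 3) (Fin 3) (FPS V)) = M
  have h2 : sol M ![0, 0, 1] 2 = 1 := by
    rw [sol_eq, Fin.sum_univ_three, ← hM]
    simp
  have h1 : sol M ![0, 0, 1] 1 = MvPowerSeries.X X := by
    rw [sol_eq, Fin.sum_univ_three, h2, ← hM]
    simp
  have h0 : sol M ![0, 0, 1] 0 = MvPowerSeries.X Y * MvPowerSeries.X X := by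
    rw [sol_eq, Fin.sum_univ_three, h1, ← hM]
    simp
  rw [Fin.sum_univ_three, h0]
  simp

theorem isSimple_twoStep (Y X : V) : (twoStep Y X).IsSimple where
  M := by
    change ∀ s t : Fin 3, _
    intro s t
    fin_cases s <;> fin_cases t <;>
      first | exact FPS.isLinear_X _ | exact FPS.isConst_zero.isLinear
  I := by
    change ∀ s : Fin 3, _
    intro s
    fin_cases s <;> first | exact FPS.isConst_one | exact FPS.isConst_zero
  F := by
    change ∀ s : Fin 3, _
    intro s
    fin_cases s <;> first | exact FPS.isConst_one | exact FPS.isConst_zero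

theorem coeff_transSubst_twoStep [DecidableEq V] {A : WAut (FPS V)} (hA : A.IsSimple) (X Y : V)
    (σ : Val V) :
    (A.transSubst Y (twoStep Y X)).coeff σ =
      ∑' τ, A.coeff τ * if τ + Finsupp.single X (τ Y) = σ then 1 else 0 := by
  classical
  -- Replacing each `Y` by `Y X` sends `τ` to `τ` plus `τ Y` copies of `X`. For `X = Y` this doubles
  -- the exponent, as it should.
  have h : (A.transSubst Y (twoStep Y X)).behavior =
      FPS.push 1 (.id _ + (Finsupp.singleAddHom X).comp (Finsupp.applyAddHom Y)) A.behavior := by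
    rw [← behavior_push hA, behavior_transSubst]
    refine Finset.sum_congr rfl fun s _ => ?_
    congr 2
    ext1 s t
    rw [Matrix.map_apply, (hA.M s t).push (X := Y), behavior_twoStep]
    · rw [MvPowerSeries.X, MvPowerSeries.X, monomial_mul_monomial]
      simp
    · intro τ hτ
      simp [hτ]
  rw [coeff, h, FPS.coeff_push]
  refine tsum_congr fun τ => ?_
  simp only [AddMonoidHom.add_apply, AddMonoidHom.id_apply, AddMonoidHom.comp_apply,
    Finsupp.singleAddHom_apply, Finsupp.applyAddHom_apply, MonoidHom.one_apply]
  congr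

/-! ### Chains -/

theorem isSimple_dirac (X : V) (n : ℕ) : (dirac X n).IsSimple where
  M s t := by
    change FPS.IsLinear (if _ then _ else _)
    split_ifs
    · exact FPS.isLinear_X X
    · exact FPS.isConst_zero.isLinear
  I s := by
    change FPS.IsConst (if _ then _ else _)
    split_ifs
    · exact FPS.isConst_one
    · exact FPS.isConst_zero
  F s := by
    change FPS.IsConst (if _ then _ else _)
    split_ifs
    · exact FPS.isConst_one
    · exact FPS.isConst_zero

theorem behavior_dirac (X : V) (n : ℕ) : (dirac X n).behavior = MvPowerSeries.X X ^ n := by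
  refine (behavior_eq _).trans ?_
  change ∑ i : Fin (n + 1), (if i.val = 0 then 1 else 0 : FPS V) *
    sol (Matrix.of fun i j : Fin (n + 1) =>
      if j.val = i.val + 1 then (MvPowerSeries.X X : FPS V) else 0)
      (fun i : Fin (n + 1) => if i.val = n then 1 else 0) i = _
  -- Here `k` is the distance to the accepting end of the chain.
  have h (k : ℕ) : ∀ i : Fin (n + 1), i.val + k = n →
      sol (Matrix.of fun i j : Fin (n + 1) =>
        if j.val = i.val + 1 then (MvPowerSeries.X X : FPS V) else 0)
        (fun i : Fin (n + 1) => if i.val = n then 1 else 0) i = MvPowerSeries.X X ^ k := by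
    induction k with
    | zero =>
      intro i hi
      rw [sol_eq, if_pos (show i.val = n from hi), Finset.sum_eq_zero, add_zero, pow_zero]
      intro j _
      rw [Matrix.of_apply, if_neg (by omega), zero_mul]
    | succ k ih =>
      intro i hi
      rw [sol_eq, if_neg (by omega), zero_add,
        Finset.sum_eq_single ⟨i.val + 1, by omega⟩ _ (by simp), Matrix.of_apply, if_pos rfl,
        ih _ (by simp only; omega), pow_succ']
      intro j _ hj
      rw [Matrix.of_apply, if_neg fun h => hj (Fin.ext h), zero_mul]
  rw [Finset.sum_eq_single 0 _ (by simp), h n 0 (by simp)]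
  · simp
  · intro j _ hj
    rw [if_neg (show ¬ j.val = 0 from fun h => hj (Fin.ext h)), zero_mul]

/-! ### Products with deterministic automata -/

/-- A right action of `ℕ^V` on the states of a deterministic automaton that extends its step
function; it exists iff the order of the letters is irrelevant. -/
structure IsAction {R : Type*} (B : DFA V R) (act : R → Val V → R) : Prop where
  zero : ∀ r, act r 0 = r
  single_add : ∀ r X σ, act r (Finsupp.single X 1 + σ) = act (B.step r X) σ

theorem IsSimple.prod {A : WAut (FPS V)} (hA : A.IsSimple) {R : Type} [Fintype R]
    (B : DFA V R) : (A.prod B).IsSimple where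
  M x y := by
    classical
    refine (hA.M x.1 y.1).of_coeff fun σ h => ?_
    change (if σ = 0 then _ else _) = (0 : ℝ≥0∞)
    split_ifs with h0
    · rw [← h0, h]
    all_goals first | rfl | exact h
  I x := by
    refine (hA.I x.1).mul ?_
    split_ifs
    · exact FPS.isConst_one
    · exact FPS.isConst_zero
  F x := by
    refine (hA.F x.1).mul ?_
    split_ifs
    · exact FPS.isConst_one
    · exact FPS.isConst_zero

-- Different paths read the letters of a monomial in different orders, but the action makes the
-- final state of `B` a function of the monomial. Acceptance therefore filters coefficients, already
-- at each path length `n`.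
open Classical in
theorem coeff_layer_of_isAction {Q R : Type*} [Fintype Q] [Fintype R] {M : Matrix Q Q (FPS V)}
    {F : Q → FPS V} (hM : ∀ s t, FPS.IsLinear (M s t)) (hF : ∀ s, FPS.IsConst (F s))
    {B : DFA V R} {act : R → Val V → R} (hB : IsAction B act)
    {T : Matrix (Q × R) (Q × R) (FPS V)} {G : Q × R → FPS V}
    (hT : ∀ x y σ, MvPowerSeries.coeff σ (T x y) =
      if σ = 0 then (if x.2 = y.2 then MvPowerSeries.coeff 0 (M x.1 y.1) else 0)
      else if ∃ X, σ = Finsupp.single X 1 ∧ B.step x.2 X = y.2 then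
        MvPowerSeries.coeff σ (M x.1 y.1)
      else 0)
    (hG : ∀ x, G x = F x.1 * if x.2 ∈ B.accept then 1 else 0)
    (n : ℕ) (s : Q) (r : R) (σ : Val V) :
    MvPowerSeries.coeff σ (layer T G n (s, r)) =
      if act r σ ∈ B.accept then MvPowerSeries.coeff σ (layer M F n s) else 0 := by
  induction n generalizing s r σ with
  | zero =>
    simp only [layer, hG]
    by_cases h : σ = 0
    · rw [h, hB.zero]
      split_ifs <;> simp
    · have h0 : MvPowerSeries.coeff σ (F s) = 0 := not_not.1 fun h0 => h (hF s σ h0)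
      split_ifs <;> simp [h0]
  | succ n ih =>
    -- By determinism only one `r'` contributes: `r` itself if `a = 0`, and `B.step r X` if `a` is
    -- the letter `X`.
    have key (t : Q) (a b : Val V) (c : ℝ≥0∞) :
        ∑ r', MvPowerSeries.coeff a (T (s, r) (t, r')) * (if act r' b ∈ B.accept then c else 0) =
          if act r (a + b) ∈ B.accept then MvPowerSeries.coeff a (M s t) * c else 0 := by
      simp only [hT]
      by_cases ha : MvPowerSeries.coeff a (M s t) = 0
      · refine (Finset.sum_eq_zero fun r' _ => ?_).trans (by simp [ha])
        by_cases h0 : a = 0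
        · subst h0
          simp [ha]
        · simp [ha, h0]
      · obtain rfl | ⟨X, rfl⟩ := hM s t a ha
        · rw [Finset.sum_eq_single r _ (by simp)]
          · simp
          · intro r' _ hr'
            simp [hr'.symm]
        · rw [Finset.sum_eq_single (B.step r X) _ (by simp), hB.single_add]
          · rw [if_neg (by simp), if_pos ⟨X, rfl, rfl⟩, mul_ite, mul_zero]
          · intro r' _ hr'
            rw [if_neg (by simp), if_neg, zero_mul]
            rintro ⟨Y, hY, h⟩
            rw [← Finsupp.single_left_injective one_ne_zero hY] at h
            exact hr' h.symm
    simp only [layer, map_sum, coeff_mul, ih, Fintype.sum_prod_type]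
    rw [Finset.ite_sum_zero]
    refine Finset.sum_congr rfl fun t _ => ?_
    rw [Finset.sum_comm]
    rw [Finset.ite_sum_zero]
    refine Finset.sum_congr rfl fun p hp => ?_
    rw [key, Finset.HasAntidiagonal.mem_antidiagonal.1 hp]

theorem coeff_prod {A : WAut (FPS V)} (hA : A.IsSimple) {R : Type} [Fintype R]
    {B : DFA V R} {act : R → Val V → R} (hB : IsAction B act) (σ : Val V)
    [Decidable (act B.start σ ∈ B.accept)] :
    (A.prod B).coeff σ = if act B.start σ ∈ B.accept then A.coeff σ else 0 := by
  classical
  have hl := coeff_layer_of_isAction hA.M hA.F hB (T := (A.prod B).M) (G := (A.prod B).F)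
    (fun _ _ _ => rfl) (fun _ => rfl)
  have hs (s : A.Q) : MvPowerSeries.coeff σ (sol (A.prod B).M (A.prod B).F (s, B.start)) =
      if act B.start σ ∈ B.accept then MvPowerSeries.coeff σ (sol A.M A.F s) else 0 := by
    refine (tsum_congr fun n => hl n s B.start σ).trans ?_
    split_ifs
    · rfl
    · exact tsum_zero
  have hb : (A.prod B).behavior = ∑ s, A.I s * sol (A.prod B).M (A.prod B).F (s, B.start) := by
    refine (behavior_eq _).trans ((Fintype.sum_prod_type _).trans (Finset.sum_congr rfl fun s _ =>
      (Finset.sum_eq_single B.start (fun r _ hr => ?_) (by simp)).trans ?_))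
    · change A.I s * (if r = B.start then 1 else 0) * _ = _
      rw [if_neg hr, mul_zero, zero_mul]
    · change A.I s * (if B.start = B.start then 1 else 0) * _ = _
      rw [if_pos rfl, mul_one]
  rw [coeff, hb, coeff, behavior_eq A, map_sum, map_sum, Finset.ite_sum_zero]
  refine Finset.sum_congr rfl fun s _ => ?_
  rw [(hA.I s).eq_C, coeff_C_mul, coeff_C_mul, hs, mul_ite, mul_zero]

end WAut

/-! ### Guards -/

/-- The atomic automata only count one letter, up to a cap or modulo `m`, so the action adds `σ X`
to the counter. Conjunctions act componentwise, and complements change only acceptance. -/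
theorem Guard.exists_isAction (φ : Guard V) : ∃ act : φ.dfa.R → Val V → φ.dfa.R,
    WAut.IsAction φ.dfa.aut act ∧
      ∀ σ, act φ.dfa.aut.start σ ∈ φ.dfa.aut.accept ↔ φ.Sat σ := by
  classical
  induction φ with
  | lt X n =>
    refine ⟨fun (i : Fin (n + 1)) σ => (⟨min (i.val + σ X) n, by omega⟩ : Fin (n + 1)),
      ⟨fun (i : Fin (n + 1)) => Fin.ext ?_, fun (i : Fin (n + 1)) Y σ => Fin.ext ?_⟩, fun σ => ?_⟩
    · have := i.is_lt
      change min (i.val + 0) n = i.val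
      omega
    · simp only [Guard.dfa, ltDFA, Finsupp.add_apply, Finsupp.single_apply]
      split_ifs
      · simp only
        omega
      · rw [zero_add]
    · change min (0 + σ X) n < n ↔ σ X < n
      omega
  | congr X m n h =>
    have hm : 0 < m := by omega
    refine ⟨fun (i : Fin m) σ => (⟨(i.val + σ X) % m, Nat.mod_lt _ hm⟩ : Fin m),
      ⟨fun (i : Fin m) => Fin.ext ?_, fun (i : Fin m) Y σ => Fin.ext ?_⟩, fun σ => ?_⟩
    · simp only [Finsupp.zero_apply, add_zero]
      exact Nat.mod_eq_of_lt i.2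
    · simp only [Guard.dfa, congrDFA, Finsupp.add_apply, Finsupp.single_apply]
      split_ifs
      · simp only [Nat.mod_add_mod, add_assoc]
      · simp only [zero_add]
    · change (0 + σ X) % m = n ↔ σ X % m = n % m
      rw [zero_add, Nat.mod_eq_of_lt h]
  | and φ ψ hφ hψ =>
    obtain ⟨a, ha, ha'⟩ := hφ
    obtain ⟨b, hb, hb'⟩ := hψ
    exact ⟨fun r σ => (a r.1 σ, b r.2 σ),
      ⟨fun r => Prod.ext (ha.zero _) (hb.zero _),
        fun r X σ => Prod.ext (ha.single_add _ _ _) (hb.single_add _ _ _)⟩,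
      fun σ => and_congr (ha' σ) (hb' σ)⟩
  | not φ hφ =>
    obtain ⟨a, ha, ha'⟩ := hφ
    exact ⟨a, ⟨ha.zero, ha.single_add⟩, fun σ => not_congr (ha' σ)⟩

/-! ### Removing one letter from a power series -/

namespace FPS

open MvPowerSeries

theorem IsLinear.ext {f g : FPS V} (hf : IsLinear f) (hg : IsLinear g)
    (h0 : coeff 0 f = coeff 0 g)
    (h1 : ∀ X, coeff (Finsupp.single X 1) f = coeff (Finsupp.single X 1) g) : f = g := by
  ext σ
  by_cases hσ : σ = 0 ∨ ∃ X, σ = Finsupp.single X 1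
  · obtain rfl | ⟨X, rfl⟩ := hσ
    · exact h0
    · exact h1 X
  · rw [not_not.1 fun h => hσ (hf σ h), not_not.1 fun h => hσ (hg σ h)]

theorem IsConst.eq_zero {f : FPS V} (hf : IsConst f) {σ : Val V} (h : σ ≠ 0) : coeff σ f = 0 :=
  not_not.1 fun h0 => h (hf σ h0)

/-- The series `g` such that `f - X g` contains no monomial in which `X` occurs. -/
noncomputable def shift (X : V) (f : FPS V) : FPS V :=
  FPS.mk fun σ => coeff (σ + Finsupp.single X 1) f

theorem coeff_shift (X : V) (f : FPS V) (σ : Val V) :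
    coeff σ (shift X f) = coeff (σ + Finsupp.single X 1) f := rfl

theorem shift_add (X : V) (f g : FPS V) : shift X (f + g) = shift X f + shift X g := rfl

theorem shift_sum {ι : Type*} (X : V) (s : Finset ι) (f : ι → FPS V) :
    shift X (∑ i ∈ s, f i) = ∑ i ∈ s, shift X (f i) := by
  ext σ
  simp only [coeff_shift, map_sum]

theorem IsConst.shift {f : FPS V} (hf : IsConst f) (X : V) : shift X f = 0 := by
  ext σ
  rw [coeff_shift, hf.eq_zero (by simp), map_zero]

theorem shift_X_mul (X : V) (f : FPS V) : shift X (MvPowerSeries.X X * f) = f := by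
  ext σ
  rw [coeff_shift, MvPowerSeries.X, add_comm, coeff_add_monomial_mul, one_mul]

/-- The part of a series in which `X` does not occur. -/
theorem exists_eq_add_X_mul_shift (X : V) (f : FPS V) :
    ∃ g : FPS V, (∀ σ, σ X ≠ 0 → coeff σ g = 0) ∧ f = g + MvPowerSeries.X X * shift X f := by
  classical
  refine ⟨FPS.mk fun σ => if σ X = 0 then coeff σ f else 0, fun σ hσ => by simp [coeff_mk, hσ], ?_⟩
  ext σ
  rw [map_add, coeff_mk]
  by_cases h : σ X = 0
  · rw [if_pos h, MvPowerSeries.X, coeff_monomial_mul, if_neg, add_zero]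
    intro hle
    have := hle X
    simp [h] at this
  · have hσ : Finsupp.single X 1 + (σ - Finsupp.single X 1) = σ := by
      refine add_tsub_cancel_of_le ?_
      simpa using Nat.one_le_iff_ne_zero.2 h
    rw [if_neg h, zero_add, ← hσ, MvPowerSeries.X, coeff_add_monomial_mul, one_mul, coeff_shift,
      add_comm]

theorem shift_mul {f : FPS V} {X : V} (hf : ∀ σ, σ X ≠ 0 → coeff σ f = 0) (g : FPS V) :
    shift X (f * g) = f * shift X g := by
  classical
  obtain ⟨g₀, h₀, hg⟩ := exists_eq_add_X_mul_shift X g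
  have h0 : shift X (f * g₀) = 0 := by
    ext σ
    rw [coeff_shift, coeff_mul, map_zero]
    refine Finset.sum_eq_zero fun p hp => ?_
    have hp := DFunLike.congr_fun (Finset.HasAntidiagonal.mem_antidiagonal.1 hp) X
    simp only [Finsupp.add_apply, Finsupp.single_eq_same] at hp
    by_cases h : p.1 X = 0
    · rw [h₀ p.2 (by omega), mul_zero]
    · rw [hf p.1 h, zero_mul]
  conv_lhs => rw [hg, mul_add, shift_add, h0, zero_add, mul_left_comm, shift_X_mul]

/-- Product rule for removing one `X`: write `f = f₀ + r X`. After `f₀` the letter must still be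
removed from `g`; after `r X` it is already gone and `g` remains intact. -/
theorem IsLinear.shift_mul {f : FPS V} (hf : IsLinear f) (X : V) (g : FPS V) :
    shift X (f * g) =
      WAut.dropLetter X f * shift X g + C (WAut.letterWeight X f) * g := by
  conv_lhs => rw [dropLetter_add X f, add_mul, shift_add,
    FPS.shift_mul fun σ hσ => hf.coeff_dropLetter_eq_zero hσ, mul_assoc, mul_left_comm, shift_X_mul]

end FPS

namespace WAut

open MvPowerSeries

open Classical in
theorem coeff_filter {A : WAut (FPS V)} (hA : A.IsSimple) (φ : Guard V) (σ : Val V) :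
    (A.filter φ).coeff σ = if φ.Sat σ then A.coeff σ else 0 := by
  obtain ⟨act, h, h'⟩ := φ.exists_isAction
  rw [filter, coeff_prod hA h]
  exact if_congr (h' σ) rfl rfl

/-! ### Decrement -/

open Classical in
theorem coeff_prod_M (A : WAut (FPS V)) {R : Type} [Fintype R] (B : DFA V R) (s t : A.Q)
    (i j : R) (σ : Val V) :
    MvPowerSeries.coeff σ ((A.prod B).M (s, i) (t, j)) =
      if σ = 0 then (if i = j then MvPowerSeries.coeff 0 (A.M s t) else 0)
      else if ∃ X, σ = Finsupp.single X 1 ∧ B.step i X = j then MvPowerSeries.coeff σ (A.M s t)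
      else 0 := rfl

open Classical in
theorem coeff_prod_compl_ltDFA_one (A : WAut (FPS V)) (X : V) (s t : A.Q)
    (i j : Fin 2) (σ : Val V) :
    MvPowerSeries.coeff σ ((A.prod (ltDFA X 1)ᶜ).M (s, i) (t, j)) =
      if σ = 0 then (if i = j then MvPowerSeries.coeff 0 (A.M s t) else 0)
      else if ∃ Y, σ = Finsupp.single Y 1 ∧ (if Y = X then 1 else i) = j then
        MvPowerSeries.coeff σ (A.M s t)
      else 0 := by
  have h (Y : V) : (ltDFA X 1)ᶜ.step i Y = if Y = X then 1 else i := by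
    refine congrArg (fun k : Fin 2 => if Y = X then k else i) (Fin.ext ?_)
    change min (i.val + 1) 1 = 1
    omega
  refine (coeff_prod_M A _ s t i j σ).trans ?_
  simp only [h]
  congr

open Classical in
theorem coeff_single_prod_compl_ltDFA_one (A : WAut (FPS V)) (X Y : V) (s t : A.Q)
    (i j : Fin 2) :
    MvPowerSeries.coeff (Finsupp.single Y 1) ((A.prod (ltDFA X 1)ᶜ).M (s, i) (t, j)) =
      if (if Y = X then 1 else i) = j then MvPowerSeries.coeff (Finsupp.single Y 1) (A.M s t)
      else 0 := by
  refine (coeff_prod_compl_ltDFA_one A X s t i j _).trans ?_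
  rw [if_neg (by simp)]
  refine if_congr ⟨?_, fun h => ⟨Y, rfl, h⟩⟩ rfl rfl
  rintro ⟨Z, hZ, h⟩
  rwa [Finsupp.single_left_injective one_ne_zero hZ]

/-- The transition matrix of the automaton `decrPos`. -/
noncomputable def decrMatrix {Q : Type*} (M : Matrix Q Q (FPS V)) (X : V) :
    Matrix (Q × Fin 2) (Q × Fin 2) (FPS V) := Matrix.of fun x y =>
  if x.2 = 0 then
    if y.2 = 0 then dropLetter X (M x.1 y.1) else C (letterWeight X (M x.1 y.1))
  else if y.2 = 0 then 0 else M x.1 y.1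

/-- Phase `0` means that no `X` has been removed yet, phase `1` that one has. The product rule for
`shift` is the recursion for phase `0`, and phase `1` just runs `A`. Final weights vanish in phase
`0` because the shift of a constant is zero. -/
theorem sol_decrMatrix {Q : Type*} [Fintype Q] {M : Matrix Q Q (FPS V)} {F : Q → FPS V}
    (hM : ∀ s t, FPS.IsLinear (M s t)) (hF : ∀ s, FPS.IsConst (F s)) (X : V) (s : Q) :
    sol (decrMatrix M X) (fun x => if x.2 = 0 then 0 else F x.1) (s, 0) =
      FPS.shift X (sol M F s) := by
  have h (n : ℕ) (s : Q) :
      layer (decrMatrix M X) (fun x => if x.2 = 0 then 0 else F x.1) n (s, 1) = layer M F n s ∧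
      layer (decrMatrix M X) (fun x => if x.2 = 0 then 0 else F x.1) n (s, 0) =
        FPS.shift X (layer M F n s) := by
    induction n generalizing s with
    | zero => simp [layer, (hF s).shift]
    | succ n ih =>
      simp only [layer, Fintype.sum_prod_type, Fin.sum_univ_two, ih, FPS.shift_sum,
        (hM _ _).shift_mul]
      simp [decrMatrix]
  ext σ
  simp only [sol, FPS.coeff_tsum, FPS.coeff_shift, h]

section Decrement

variable {A : WAut (FPS V)} (hA : A.IsSimple) (X : V)
include hA

theorem IsSimple.decrPos : (A.decrPos X).IsSimple where
  M x y := by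
    change FPS.IsLinear (if _ then _ else _)
    split_ifs
    · exact ((hA.prod _).M x y).substLabel X 1
    · exact (hA.prod _).M x y
  I := (hA.prod _).I
  F := (hA.prod _).F

/-- Linear series are determined by their constant and letter coefficients, which are compared for
the four pairs of phases. The block from phase `1` to `0` is zero because the guard automaton never
returns. -/
theorem decrPos_M : (A.decrPos X).M = decrMatrix A.M X := by
  classical
  refine Matrix.ext ?_
  rintro ⟨s, i⟩ ⟨t, j⟩
  have h : (A.decrPos X).M (s, i) (t, j) = if i = 0 ∧ j = 1 then
      substLabel X 1 ((A.prod (ltDFA X 1)ᶜ).M (s, i) (t, j))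
      else (A.prod (ltDFA X 1)ᶜ).M (s, i) (t, j) := rfl
  have h0 := coeff_prod_compl_ltDFA_one A X s t i j 0
  have h1 := fun Y => coeff_single_prod_compl_ltDFA_one A X Y s t i j
  have hl : FPS.IsLinear ((A.prod (ltDFA X 1)ᶜ).M (s, i) (t, j)) := (hA.prod _).M _ _
  have hf := hA.M s t
  refine h.trans ?_
  change _ = (if i = 0 then
    if j = 0 then dropLetter X (A.M s t) else C (letterWeight X (A.M s t))
    else if j = 0 then 0 else A.M s t : FPS V)
  generalize A.M s t = f at h0 h1 hf
  generalize (A.prod (ltDFA X 1)ᶜ).M (s, i) (t, j) = g at h0 h1 hl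
  rw [if_pos rfl] at h0
  have hij : (i = 0 ∨ i = 1) ∧ (j = 0 ∨ j = 1) := by omega
  obtain ⟨rfl | rfl, rfl | rfl⟩ := hij
  · rw [if_neg (by simp), if_pos rfl, if_pos rfl]
    refine hl.ext (hf.dropLetter X) ?_ fun Y => ?_
    · rw [h0, FPS.coeff_dropLetter, if_pos rfl, if_neg (by simp [eq_comm])]
    · rw [h1, FPS.coeff_dropLetter]
      by_cases hY : Y = X
      · simp [hY]
      · simp [hY, Finsupp.single_left_inj]
  · rw [if_pos ⟨rfl, rfl⟩, if_pos rfl, if_neg (by simp)]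
    refine (hl.substLabel X 1).ext (FPS.isConst_C _).isLinear ?_ fun Y => ?_
    · rw [substLabel, map_add, FPS.coeff_dropLetter, h0]
      simp [letterWeight, h1]
    · rw [substLabel, map_add, FPS.coeff_dropLetter, h1]
      by_cases hY : Y = X
      · simp [hY, coeff_C]
      · simp [hY, coeff_C]
  · rw [if_neg (by simp), if_neg (by simp), if_pos rfl]
    refine hl.ext FPS.isConst_zero.isLinear ?_ fun Y => ?_
    · simpa using h0
    · rw [h1]
      by_cases hY : Y = X <;> simp [hY]
  · rw [if_neg (by simp), if_neg (by simp), if_neg (by simp)]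
    refine hl.ext hf ?_ fun Y => ?_
    · simpa using h0
    · rw [h1]
      by_cases hY : Y = X <;> simp [hY]

theorem coeff_decrPos (σ : Val V) :
    (A.decrPos X).coeff σ = A.coeff (σ + Finsupp.single X 1) := by
  classical
  have hF : (A.decrPos X).F = fun x : A.Q × Fin 2 => if x.2 = 0 then 0 else A.F x.1 := by
    funext ⟨s, i⟩
    have h : (A.decrPos X).F (s, i) =
        A.F s * @ite _ (¬ i.val < 1) (Classical.propDecidable _) 1 0 := rfl
    refine h.trans ?_
    have hi : i = 0 ∨ i = 1 := by omega
    obtain rfl | rfl := hi <;> simp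
  have hI : (A.decrPos X).I = fun x : A.Q × Fin 2 => if x.2 = 0 then A.I x.1 else 0 := by
    funext ⟨s, i⟩
    have h : (A.decrPos X).I (s, i) =
        A.I s * @ite _ (i = 0) (Classical.propDecidable _) 1 0 := rfl
    refine h.trans ?_
    have hi : i = 0 ∨ i = 1 := by omega
    obtain rfl | rfl := hi <;> simp
  have hb : (A.decrPos X).behavior = FPS.shift X A.behavior := by
    refine (behavior_eq _).trans ?_
    rw [decrPos_M hA, hF, hI, behavior_eq A, FPS.shift_sum]
    refine (Fintype.sum_prod_type _).trans (Finset.sum_congr rfl fun s _ =>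
      (Fin.sum_univ_two _).trans ?_)
    rw [FPS.shift_mul, ← sol_decrMatrix hA.M hA.F]
    · exact (congrArg (_ + ·) (zero_mul _)).trans (add_zero _)
    · exact fun τ hτ => (hA.I s).eq_zero fun h => hτ (by rw [h]; rfl)
  rw [coeff, hb]
  rfl

theorem IsSimple.decr : (A.decr X).IsSimple :=
  (hA.decrPos X).wunion (hA.labelSubst X 0) 1 1

theorem coeff_decr [DecidableEq V] (σ : Val V) :
    (A.decr X).coeff σ = A.coeff (σ + Finsupp.single X 1) + if σ X = 0 then A.coeff σ else 0 := by
  rw [WAut.decr, coeff_wunion, coeff_decrPos hA, coeff_labelSubst_zero hA, one_mul, one_mul]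

end Decrement

end WAut

/-! ### Sums over outcomes and updates of valuations -/

theorem tsum_option_ennreal {α : Type*} (f : Option α → ℝ≥0∞) :
    ∑' o, f o = f none + ∑' a, f (some a) := by
  rw [← (Equiv.optionEquivSumPUnit.{0} α).symm.tsum_eq,
    ENNReal.summable.tsum_sum ENNReal.summable, add_comm]
  simp

theorem _root_.Finsupp.update_add_eq_add_single {V : Type*} (σ : V →₀ ℕ) (X : V) (n : ℕ) :
    σ.update X (σ X + n) = σ + Finsupp.single X n := by
  classical
  ext Y
  by_cases h : Y = X
  · subst h
    simp
  · simp [Finsupp.update_apply, h]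

/-- The fiber of the truncated decrement has a second point exactly when truncation occurs; the two
cases match the two parts of the automaton `decr`. -/
theorem _root_.Finsupp.update_sub_one_eq_iff {V : Type*} (σ τ : V →₀ ℕ) (X : V) :
    τ.update X (τ X - 1) = σ ↔ τ = σ + Finsupp.single X 1 ∨ (τ = σ ∧ σ X = 0) := by
  classical
  constructor
  · rintro rfl
    by_cases h : τ X = 0
    · have h' : τ X - 1 = τ X := by omega
      simp only [h', Finsupp.update_self]
      exact .inr ⟨trivial, h⟩
    · left
      ext Y
      by_cases hY : Y = X
      · subst hY
        simp
        omega
      · simp [hY]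
  · rintro (rfl | ⟨rfl, h⟩)
    · ext Y
      by_cases hY : Y = X
      · subst hY
        simp
      · simp [hY]
    · have h' : τ X - 1 = τ X := by omega
      rw [h', Finsupp.update_self]

namespace WAut

open MvPowerSeries

open Classical in
theorem coeff_dirac (X : V) (n : ℕ) (σ : Val V) : (dirac X n).coeff σ =
    if σ = Finsupp.single X (σ X) then PMF.pure n (σ X) else 0 := by
  rw [coeff, behavior_dirac, X_pow_eq, coeff_monomial, PMF.pure_apply]
  by_cases h : σ = Finsupp.single X n
  · subst h
    simp
  · rw [if_neg h]
    split_ifs with h1 h2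
    · exact absurd (h2 ▸ h1) h
    · rfl
    · rfl

open Classical in
theorem coeff_concat_of_coeff_eq {A B : WAut (FPS V)} {X : V} {D : PMF ℕ}
    (hB : ∀ σ : Val V, B.coeff σ = if σ = Finsupp.single X (σ X) then D (σ X) else 0)
    (σ : Val V) : (A.concat B).coeff σ = ∑' τ, A.coeff τ *
      D.map (fun n => some (τ.update X (τ X + n))) (some σ) := by
  rw [coeff_concat]
  refine tsum_congr fun τ => ?_
  rw [PMF.map_apply]
  congr 1
  -- The coefficients of `B` vanish off the powers of `X`, so the sum over `ρ` reduces to one over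
  -- exponents.
  rw [← (Finsupp.single_injective X).tsum_eq]
  · refine tsum_congr fun n => ?_
    rw [hB, Finsupp.single_eq_same, if_pos rfl, Finsupp.update_add_eq_add_single]
    simp [eq_comm]
  · intro ρ hρ
    rw [Function.mem_support, hB] at hρ
    by_contra h
    refine hρ ?_
    rw [if_neg fun h' => h ⟨_, h'.symm⟩, zero_mul]

end WAut

/-! ### Agreement of the automata transformer with the outcome semantics -/

section Soundness

variable {𝒟 : V → PMF ℕ → WAut (FPS V)}
  (h𝒟 : ∀ (X : V) (D : PMF ℕ), PGADefinable X D → (𝒟 X D).Represents X D)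
include h𝒟

theorem Prog.isSimple_trans (P : Prog V) {A : WAut (FPS V)} (hA : A.IsSimple) :
    (P.trans 𝒟 A).IsSimple := by
  induction P generalizing A with
  | setZero X => exact hA.labelSubst X 1
  | incrConst X n => exact hA.concat (WAut.isSimple_dirac X n)
  | incrSample X D hD => exact hA.concat ((h𝒟 X D hD).1.isSimple (h𝒟 X D hD).2.1)
  | incrVar X Y => exact hA.transSubst (WAut.isSimple_twoStep Y X) Y
  | choice P₁ p P₂ h₁ h₂ => exact (h₁ hA).wunion (h₂ hA) _ _
  | ite φ P₁ P₂ h₁ h₂ => exact (h₁ (hA.prod _)).wunion (h₂ (hA.prod _)) _ _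
  | decr X => exact hA.decr X
  | observe φ => exact hA.prod _
  | seq P₁ P₂ h₁ h₂ => exact h₂ (h₁ hA)

/-- On behaviors the transformer is the linear map with kernel `P.den`. The induction ranges over
all simple `A`, because sequencing and branching apply it to intermediate automata. -/
theorem Prog.coeff_trans (P : Prog V) {A : WAut (FPS V)} (hA : A.IsSimple) (σ : Val V) :
    (P.trans 𝒟 A).coeff σ = ∑' τ, A.coeff τ * P.den τ (some σ) := by
  classical
  induction P generalizing A σ with
  | setZero X =>
    simp only [Prog.trans, Prog.den, WAut.coeff_labelSubst_one hA, PMF.pure_apply,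
      Option.some_inj, Finsupp.erase_eq_update_zero, eq_comm]
  | incrConst X n =>
    simp only [Prog.trans, Prog.den]
    rw [WAut.coeff_concat_of_coeff_eq (WAut.coeff_dirac X n)]
    simp only [PMF.pure_map]
  | incrSample X D hD =>
    simp only [Prog.trans, Prog.den]
    exact WAut.coeff_concat_of_coeff_eq (h𝒟 X D hD).2.2 σ
  | incrVar X Y =>
    simp only [Prog.trans, Prog.den, WAut.coeff_transSubst_twoStep hA, PMF.pure_apply,
      Option.some_inj, Finsupp.update_add_eq_add_single, eq_comm]
  | choice P₁ p P₂ h₁ h₂ =>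
    simp only [Prog.trans, Prog.den, WAut.coeff_wunion, h₁ hA, h₂ hA, PMF.bind_apply, tsum_bool,
      ← ENNReal.tsum_mul_left, ← ENNReal.tsum_add, coin, PMF.ofFintype_apply, if_true,
      Bool.false_eq_true, if_false]
    refine tsum_congr fun τ => ?_
    ring
  | ite φ P₁ P₂ h₁ h₂ =>
    simp only [Prog.trans, Prog.den, WAut.coeff_wunion, WAut.filter, h₁ (hA.prod _),
      h₂ (hA.prod _), one_mul, ← ENNReal.tsum_add]
    refine tsum_congr fun τ => ?_
    change (A.filter φ).coeff τ * _ + (A.filter φ.not).coeff τ * _ = _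
    rw [WAut.coeff_filter hA, WAut.coeff_filter hA]
    by_cases h : φ.Sat τ <;> simp [Guard.Sat, h]
  | decr X =>
    simp only [Prog.trans, Prog.den, WAut.coeff_decr hA, PMF.pure_apply, Option.some_inj]
    have h (τ : Val V) : (A.coeff τ * if σ = τ.update X (τ X - 1) then 1 else 0) =
        (if τ = σ + Finsupp.single X 1 then A.coeff τ else 0) +
          if τ = σ then (if σ X = 0 then A.coeff τ else 0) else 0 := by
      simp only [eq_comm (a := σ) (b := τ.update X _), Finsupp.update_sub_one_eq_iff]
      by_cases h1 : τ = σ + Finsupp.single X 1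
      · have h2 : τ ≠ σ := by
          rintro rfl
          simpa using DFunLike.congr_fun h1 X
        simp [h1]
      · by_cases h2 : τ = σ <;> simp [h1, h2]
    simp only [h]
    rw [ENNReal.tsum_add, tsum_ite_eq, tsum_ite_eq]
  | observe φ =>
    simp only [Prog.trans, Prog.den, WAut.coeff_filter hA, PMF.pure_apply]
    rw [tsum_eq_single σ]
    · by_cases h : φ.Sat σ <;> simp [h]
    · intro τ hτ
      by_cases h : φ.Sat τ <;> simp [h, hτ.symm]
  | seq P₁ P₂ h₁ h₂ =>
    simp only [Prog.trans, Prog.den, h₂ (Prog.isSimple_trans h𝒟 P₁ hA), h₁ hA, PMF.bind_apply,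
      tsum_option_ennreal, Option.elim_none, Option.elim_some, PMF.pure_apply, reduceCtorEq,
      if_false, mul_zero, zero_add]
    -- The outcome `none` of `P₁` has dropped out, as it cannot lead to `some σ`; what is left is an
    -- exchange of two sums.
    simp only [← ENNReal.tsum_mul_right, ← ENNReal.tsum_mul_left, mul_assoc]
    exact ENNReal.tsum_comm

/-- Each `P.den τ` has total mass one, so the weight of `τ` is divided between termination and
failure. The additive form needs no finiteness. -/
theorem Prog.mass_trans_add (P : Prog V) {A : WAut (FPS V)} (hA : A.IsSimple) :
    (P.trans 𝒟 A).mass + ∑' τ, A.coeff τ * P.den τ none = A.mass := by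
  simp only [WAut.mass, Prog.coeff_trans h𝒟 P hA]
  rw [ENNReal.tsum_comm, ← ENNReal.tsum_add]
  refine tsum_congr fun τ => ?_
  rw [ENNReal.tsum_mul_left, ← mul_add, add_comm, ← tsum_option_ennreal, PMF.tsum_coe, mul_one]

end Soundness

theorem pathMeasure_univ [Finite V] (A : WAut (FPS V)) (P : Prog V) :
    pathMeasure A P Set.univ = A.mass := by
  have h := lintegral_pathMeasure_zero A P 1
  simpa [WAut.mass] using h

end ReDiP

open ReDiP in
theorem mainTheorem1 {V : Type*} [Finite V]
    (𝒟 : V → PMF ℕ → WAut (FPS V))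
    (h𝒟 : ∀ (X : V) (D : PMF ℕ), PGADefinable X D → (𝒟 X D).Represents X D)
    (A : WAut (FPS V)) (hA : A.IsPGA) (hA' : A.IsNormalized) (P : Prog V) :
    (∀ σ : Val V, pathMeasure A P (eventually (.term σ)) = (P.trans 𝒟 A).coeff σ) ∧
    pathMeasure A P (eventually .fail) = A.mass - (P.trans 𝒟 A).mass ∧
    (P.trans 𝒟 A).mass ≤ A.mass ∧
    ∀ N : WAut (FPS V), (P.trans 𝒟 A).normalize = some N → ∀ σ : Val V,
      N.coeff σ = (pathMeasure A P)[eventually (.term σ) | (eventually .fail)ᶜ] := by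
  have hS := hA.isSimple hA'
  have hmass := P.mass_trans_add h𝒟 hS
  -- Finiteness of the mass makes the subtractions in `[0, ∞]` below legitimate.
  have hfin : A.mass ≠ ⊤ := (hA.2.2.2.trans_lt ENNReal.one_lt_top).ne
  have hle : (P.trans 𝒟 A).mass ≤ A.mass := hmass ▸ le_self_add
  have hterm (σ : Val V) : pathMeasure A P (eventually (.term σ)) = (P.trans 𝒟 A).coeff σ :=
    (pathMeasure_eventually A P (some σ)).trans (P.coeff_trans h𝒟 hS σ).symm
  have hfail : pathMeasure A P (eventually .fail) = A.mass - (P.trans 𝒟 A).mass := by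
    refine (pathMeasure_eventually A P none).trans ?_
    rw [← hmass, ENNReal.add_sub_cancel_left (ne_top_of_le_ne_top hfin hle)]
  refine ⟨hterm, hfail, hle, fun N hN σ => ?_⟩
  have hsub : pathMeasure A P (eventually .fail) ≤ A.mass := hfail ▸ tsub_le_self
  have hcompl : pathMeasure A P (eventually .fail)ᶜ = (P.trans 𝒟 A).mass := by
    rw [measure_compl (measurableSet_eventually _) (ne_top_of_le_ne_top hfin hsub),
      pathMeasure_univ, hfail, ENNReal.sub_sub_cancel hfin hle]
  -- Almost no run reaches both `⟨↓, σ⟩` and failure, so the intersection with non-failure loses no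
  -- mass.
  have hinter : pathMeasure A P ((eventually .fail)ᶜ ∩ eventually (.term σ)) =
      (P.trans 𝒟 A).coeff σ := by
    rw [← hterm σ]
    refine measure_congr (Filter.eventuallyEq_set.2 ?_)
    filter_upwards [ae_not_mem_eventually_inter A P (o := some σ) (o' := none) (by simp)] with ω h
    exact ⟨fun h' => h'.2, fun h' => ⟨h h', h'⟩⟩
  rw [cond_apply (measurableSet_eventually _).compl, hcompl, hinter]
  unfold WAut.normalize at hN
  split_ifs at hN
  obtain rfl := Option.some.inj hN
  rw [← one_div]
  exact WAut.coeff_smul_initial _ _ σ
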